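/- **Definitions.** An ortholattice is a bounded lattice $(L,\vee,\wedge,0,1)$ with a unary operation $x\mapsto x^\perp$ such that $x\le y\Rightarrow y^\perp\le x^\perp$, $x^{\perp\perp}=x$, $x\vee x^\perp=1$ and $x\wedge x^\perp=0$; it is complete if every subset has a supremum and an infimum. An extension of an ortholattice $L$ is an ortholattice containing $L$ as a subortholattice. An orthopolynomial over an ortholattice $M$ is a term built from variables and elements of $M$ with $\vee,\wedge,{}^\perp$. For bounded lattices, $L_0\trianglelefteq L_1$ means: $L_0$ is a sublattice of $L_1$ with the same $0$ and $1$; for every $x\in L_1$ the set $\{z\in L_0: z\le x\}$ has a greatest element; and whenever $z\in L_0\setminus\{1\}$, $x\in L_1$, $x\le z$, then $x\in L_0$. If $L_0$ is an ortholattice and $L_0\trianglelefteq L_1$, then $\mathrm{ortho}(L_1,L_0)$ is the following ortholattice: take a set $L_2$ with $L_1\cap L_2=L_0$ and a bijection $\iota:L_1\to L_2$ with $\iota(z)=z^{\perp}$ for $z\in L_0$, order $L_2$ so that $\iota$ is a dual isomorphism, order $L_1\cup L_2$ by the transitive closure of the union of the two orders, and let $x^\perp=\iota(x)$ for $x\in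 L_1$, $x^\perp=\iota^{-1}(x)$ for $x\in L_2$. A subset $A$ of a bounded lattice $M$ is convex in $M$ if $a,a'\in A$, $x\in M$ and $0<a\le x\le a'<1$ imply $x\in A$. A lattice $M$ is $\kappa$-power closed if for every sublattice $S$ of $M$ with $|S|\le\kappa$ there is a sublattice $S'$ of $M$ with $|S'|\le\kappa$ that is isomorphic to $S\times S$. **Theorem.** Let $L$ be a complete ortholattice and let $\kappa$ be any cardinal. Then: 1. There is a complete lattice $L_1$ with $L\trianglelefteq L_1$ such that $\bar L=\mathrm{ortho}(L_1,L)$ is a complete ortholattice extending $L$, and for every function $f:L\to L$ there is an orthopolynomial $p(\mathtt x)$ with coefficients in $\bar L$ such that $p(a)=f(a)$ for all $a\in L$. Moreover, $L$ is convex in $\bar L$, and, if $\kappa$ is infinite, $\bar L$ is $\kappa$-power closed (for the same $\bar L$). 2. There is a complete ortholattice $\hat L$ extending $L$ such that for every natural number $n$, every function $f:\hat L^n\to\hat L$ and every set $A\subseteq\hat L^n$ of cardinality at most $\kappa$, there is an orthopolynomial $p(\mathtt x_1,\dots,\mathtt x_n)$ with coefficients in $\hat L$ such that $p(a)=f(a)$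 for all $a\in A$. -/

import Mathlib

universe u v w

/-- An ortholattice: a bounded lattice with an order-reversing involution `x ↦ xᶜ`
such that `x ⊔ xᶜ = ⊤` and `x ⊓ xᶜ = ⊥`. -/
class Ortholattice (α : Type u) extends Lattice α, BoundedOrder α, Compl α where
  compl_le_compl' : ∀ x y : α, x ≤ y → yᶜ ≤ xᶜ
  compl_compl' : ∀ x : α, xᶜᶜ = x
  sup_compl' : ∀ x : α, x ⊔ xᶜ = ⊤
  inf_compl' : ∀ x : α, x ⊓ xᶜ = ⊥

/-- Completeness of a partial order: every subset has a supremum and an infimum. -/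
def IsCompleteOrder (α : Type u) [PartialOrder α] : Prop :=
  ∀ s : Set α, (∃ a, IsLUB s a) ∧ (∃ b, IsGLB s b)

/-- `j` embeds the ortholattice `α` into `β` as a subortholattice, i.e. (up to the
identification of `α` with its image) `β` extends `α`. -/
structure IsOrthoEmbedding {α : Type u} {β : Type v} [Ortholattice α] [Ortholattice β]
    (j : α → β) : Prop where
  injective : Function.Injective j
  map_sup : ∀ x y, j (x ⊔ y) = j x ⊔ j y
  map_inf : ∀ x y, j (x ⊓ y) = j x ⊓ j y
  map_bot : j ⊥ = ⊥
  map_top : j ⊤ = ⊤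
  map_compl : ∀ x, j xᶜ = (j x)ᶜ

/-- Convexity in a bounded lattice, in the sense that `A \ {⊥, ⊤}` is convex. -/
def IsConvexIn {α : Type u} [Lattice α] [BoundedOrder α] (A : Set α) : Prop :=
  ∀ a ∈ A, ∀ a' ∈ A, ∀ x : α, ⊥ < a → a ≤ x → x ≤ a' → a' < ⊤ → x ∈ A

/-- Orthopolynomials over `α` in the variables `σ`: terms built from variables and
coefficients in `α` with the ortholattice operations. -/
inductive OrthoPoly (α : Type u) (σ : Type v) : Type (max u v) where
  | var : σ → OrthoPoly α σ
  | const : α → OrthoPoly α σ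
  | sup : OrthoPoly α σ → OrthoPoly α σ → OrthoPoly α σ
  | inf : OrthoPoly α σ → OrthoPoly α σ → OrthoPoly α σ
  | compl : OrthoPoly α σ → OrthoPoly α σ

/-- Evaluation of an orthopolynomial at a point. -/
def OrthoPoly.eval {α : Type u} {σ : Type v} [Ortholattice α] (x : σ → α) :
    OrthoPoly α σ → α
  | .var i => x i
  | .const a => a
  | .sup p q => p.eval x ⊔ q.eval x
  | .inf p q => p.eval x ⊓ q.eval x
  | .compl p => (p.eval x)ᶜ

/-- A family of sublattices is power closed if with every `S` it contains an isomorphic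
copy of `S × S`. -/
def PowerClosed {α : Type u} [Lattice α] (F : Set (Sublattice α)) : Prop :=
  ∀ S ∈ F, ∃ S' ∈ F, Nonempty (S' ≃o S × S)

/-- `α` is `κ`-power closed if the family of its sublattices of size `≤ κ` is. -/
def KappaPowerClosed (κ : Cardinal.{u}) (α : Type u) [Lattice α] : Prop :=
  PowerClosed {S : Sublattice α | Cardinal.mk S ≤ κ}

/-- `L₀ ⊴ L₁` along the `{0,1}`-lattice homomorphism `e : L₀ → L₁`: `e` is an embedding,
every `x : L₁` has a projection to `L₀` (a greatest element of `L₀` below it), and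
`L₀ \ {1}` is downward closed in `L₁`. -/
structure IsTriExt {L₀ : Type u} {L₁ : Type v} [Lattice L₀] [BoundedOrder L₀]
    [Lattice L₁] [BoundedOrder L₁] (e : BoundedLatticeHom L₀ L₁) : Prop where
  injective : Function.Injective e
  exists_proj : ∀ x : L₁, ∃ w : L₀, IsGreatest {z : L₀ | e z ≤ x} w
  downward : ∀ z : L₀, z ≠ ⊤ → ∀ x : L₁, x ≤ e z → x ∈ Set.range e

section OrthoConstruction

variable {L₀ : Type u} {L₁ : Type v} [Ortholattice L₀] [Lattice L₁] [BoundedOrder L₁]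
  {e : BoundedLatticeHom L₀ L₁}

namespace IsTriExt

/-- The projection `L₁ → L₀`. -/
noncomputable def proj (h : IsTriExt e) (x : L₁) : L₀ := (h.exists_proj x).choose

theorem proj_spec (h : IsTriExt e) (x : L₁) : IsGreatest {z : L₀ | e z ≤ x} (h.proj x) :=
  (h.exists_proj x).choose_spec

theorem le_iff (h : IsTriExt e) {a b : L₀} : e a ≤ e b ↔ a ≤ b := by
  rw [← inf_eq_left, ← map_inf, h.injective.eq_iff, inf_eq_left]

end IsTriExt

/-- The underlying set of `ortho(L₁, L₀)`: the union of `L₁` and a copy `L₂` of `L₁` with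
`L₁ ∩ L₂ = L₀`; thus `L₂ \ L₀` is a disjoint copy of `L₁ \ L₀`. -/
inductive Ortho {L₀ : Type u} {L₁ : Type v} [Ortholattice L₀] [Lattice L₁] [BoundedOrder L₁]
    {e : BoundedLatticeHom L₀ L₁} (h : IsTriExt e) : Type v where
  | ofL₁ : L₁ → Ortho h
  /-- The copy of `L₁ \ L₀`. -/
  | copy : {x : L₁ // x ∉ Set.range e} → Ortho h

namespace Ortho

/-- The inclusion of `L₁`. -/
def inL (h : IsTriExt e) (x : L₁) : Ortho h := ofL₁ x

open Classical in
/-- The bijection `ι` of `L₁` onto `L₂`: it sends `z ∈ L₀` to the orthocomplement of `z`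
in `L₀`, and `x ∈ L₁ \ L₀` to its copy. -/
noncomputable def iota (h : IsTriExt e) (x : L₁) : Ortho h :=
  if hx : x ∈ Set.range e then inL h (e (hx.choose)ᶜ) else copy ⟨x, hx⟩

/-- The orthocomplement: `ι` on `L₁` and `ι⁻¹` on `L₂`. -/
noncomputable def perp (h : IsTriExt e) : Ortho h → Ortho h
  | .ofL₁ x => iota h x
  | .copy x => inL h x.1

/-- The order `≤₁` of `L₁`. -/
def le₁ (h : IsTriExt e) (a b : Ortho h) : Prop :=
  ∃ x y : L₁, x ≤ y ∧ a = inL h x ∧ b = inL h y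

/-- The order `≤₂` of `L₂`, for which `ι` is a dual isomorphism. -/
def le₂ (h : IsTriExt e) (a b : Ortho h) : Prop :=
  ∃ x y : L₁, y ≤ x ∧ a = iota h x ∧ b = iota h y

/-- The order of `ortho(L₁, L₀)`: the transitive closure of the union of `≤₁` and `≤₂`. -/
instance (h : IsTriExt e) : LE (Ortho h) :=
  ⟨Relation.TransGen fun a b => le₁ h a b ∨ le₂ h a b⟩

theorem inL_injective (h : IsTriExt e) : Function.Injective (inL h) :=
  fun _ _ hxy => Ortho.ofL₁.inj hxy

theorem iota_apply (h : IsTriExt e) (z : L₀) : iota h (e z) = inL h (e zᶜ) := by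
  have hx : e z ∈ Set.range e := ⟨z, rfl⟩
  have : hx.choose = z := h.injective hx.choose_spec
  rw [iota, dif_pos hx, this]

theorem iota_of_notMem (h : IsTriExt e) {x : L₁} (hx : x ∉ Set.range e) :
    iota h x = copy ⟨x, hx⟩ := by
  rw [iota, dif_neg hx]

theorem perp_inL (h : IsTriExt e) (x : L₁) : perp h (inL h x) = iota h x := rfl

theorem perp_iota (h : IsTriExt e) (x : L₁) : perp h (iota h x) = inL h x := by
  by_cases hx : x ∈ Set.range e
  · obtain ⟨z, rfl⟩ := hx
    rw [iota_apply, perp_inL, iota_apply, Ortholattice.compl_compl']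
  · rw [iota_of_notMem h hx]; rfl

theorem exists_rep (h : IsTriExt e) (a : Ortho h) :
    (∃ x, a = inL h x) ∨ (∃ x, a = iota h x) := by
  rcases a with x | ⟨x, hx⟩
  · exact Or.inl ⟨x, rfl⟩
  · exact Or.inr ⟨x, (iota_of_notMem h hx).symm⟩

theorem perp_perp (h : IsTriExt e) (a : Ortho h) : perp h (perp h a) = a := by
  rcases exists_rep h a with ⟨x, rfl⟩ | ⟨x, rfl⟩
  · rw [perp_inL, perp_iota]
  · rw [perp_iota, perp_inL]

theorem iota_injective (h : IsTriExt e) : Function.Injective (iota h) := fun x y hxy =>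
  inL_injective h (by rw [← perp_iota, hxy, perp_iota])

theorem inL_eq_iota (h : IsTriExt e) {x y : L₁} (hxy : inL h x = iota h y) :
    ∃ z, x = e z ∧ y = e zᶜ := by
  by_cases hy : y ∈ Set.range e
  · obtain ⟨z, rfl⟩ := hy
    rw [iota_apply] at hxy
    exact ⟨zᶜ, inL_injective h hxy, by rw [Ortholattice.compl_compl']⟩
  · rw [iota_of_notMem h hy] at hxy
    exact absurd hxy (by simp [inL])

theorem compl_le_iff {α : Type u} [Ortholattice α] {x y : α} : xᶜ ≤ yᶜ ↔ y ≤ x := by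
  refine ⟨fun hxy => ?_, Ortholattice.compl_le_compl' _ _⟩
  have := Ortholattice.compl_le_compl' _ _ hxy
  rwa [Ortholattice.compl_compl', Ortholattice.compl_compl'] at this

theorem compl_inf_le {α : Type u} [Ortholattice α] {x y t : α} (hx : xᶜ ≤ t) (hy : yᶜ ≤ t) :
    (x ⊓ y)ᶜ ≤ t := by
  rw [← Ortholattice.compl_compl' t, compl_le_iff] at *
  exact le_inf hx hy

theorem compl_top' (α : Type u) [Ortholattice α] : (⊤ : α)ᶜ = ⊥ := by
  rw [← Ortholattice.inf_compl' (⊤ : α), top_inf_eq]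

theorem compl_bot' (α : Type u) [Ortholattice α] : (⊥ : α)ᶜ = ⊤ := by
  rw [← compl_top' α, Ortholattice.compl_compl']

theorem iota_bot (h : IsTriExt e) : iota h ⊥ = inL h ⊤ := by
  rw [← map_bot e, iota_apply, compl_bot', map_top]

theorem iota_top (h : IsTriExt e) : iota h ⊤ = inL h ⊥ := by
  rw [← map_top e, iota_apply, compl_top', map_bot]

/-- The explicit description of the transitive closure. -/
def Rel (h : IsTriExt e) (a b : Ortho h) : Prop :=
  le₁ h a b ∨ le₂ h a b ∨
    ∃ (x y : L₁) (z : L₀), e zᶜ ≤ x ∧ e z ≤ y ∧ a = iota h x ∧ b = inL h y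

theorem rel_inL_inL (h : IsTriExt e) {x y : L₁} : Rel h (inL h x) (inL h y) ↔ x ≤ y := by
  constructor
  · rintro (⟨a, b, hab, ha, hb⟩ | ⟨a, b, hab, ha, hb⟩ | ⟨a, b, z, hza, hzb, ha, hb⟩)
    · rwa [inL_injective h ha, inL_injective h hb]
    · obtain ⟨s, rfl, rfl⟩ := inL_eq_iota h ha
      obtain ⟨t, rfl, rfl⟩ := inL_eq_iota h hb
      rw [h.le_iff, compl_le_iff] at hab
      exact h.le_iff.2 hab
    · obtain ⟨s, rfl, rfl⟩ := inL_eq_iota h ha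
      rw [inL_injective h hb]
      rw [h.le_iff, compl_le_iff] at hza
      exact (h.le_iff.2 hza).trans hzb
  · intro hxy
    exact Or.inl ⟨x, y, hxy, rfl, rfl⟩

theorem rel_iota_inL (h : IsTriExt e) {x y : L₁} :
    Rel h (iota h x) (inL h y) ↔ ∃ z, e zᶜ ≤ x ∧ e z ≤ y := by
  constructor
  · rintro (⟨a, b, hab, ha, hb⟩ | ⟨a, b, hab, ha, hb⟩ | ⟨a, b, z, hza, hzb, ha, hb⟩)
    · obtain ⟨s, rfl, rfl⟩ := inL_eq_iota h ha.symm
      cases inL_injective h hb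
      exact ⟨s, le_rfl, hab⟩
    · obtain ⟨s, rfl, rfl⟩ := inL_eq_iota h hb
      cases iota_injective h ha
      exact ⟨s, hab, le_rfl⟩
    · cases iota_injective h ha
      cases inL_injective h hb
      exact ⟨z, hza, hzb⟩
  · rintro ⟨z, hx, hy⟩
    exact Or.inr (Or.inr ⟨x, y, z, hx, hy, rfl, rfl⟩)

theorem rel_iota_iota (h : IsTriExt e) {x y : L₁} :
    Rel h (iota h x) (iota h y) ↔ y ≤ x := by
  constructor
  · rintro (⟨a, b, hab, ha, hb⟩ | ⟨a, b, hab, ha, hb⟩ | ⟨a, b, z, hza, hzb, ha, hb⟩)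
    · obtain ⟨s, rfl, rfl⟩ := inL_eq_iota h ha.symm
      obtain ⟨t, rfl, rfl⟩ := inL_eq_iota h hb.symm
      rw [h.le_iff] at hab
      exact h.le_iff.2 (compl_le_iff.2 hab)
    · rwa [iota_injective h ha, iota_injective h hb]
    · obtain ⟨s, rfl, rfl⟩ := inL_eq_iota h hb.symm
      cases iota_injective h ha
      rw [h.le_iff] at hzb
      exact (h.le_iff.2 (compl_le_iff.2 hzb)).trans hza
  · intro hxy
    exact Or.inr (Or.inl ⟨x, y, hxy, rfl, rfl⟩)

theorem rel_inL_iota (h : IsTriExt e) {x y : L₁} :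
    Rel h (inL h x) (iota h y) ↔ ∃ z, x ≤ e z ∧ y ≤ e zᶜ := by
  constructor
  · rintro (⟨a, b, hab, ha, hb⟩ | ⟨a, b, hab, ha, hb⟩ | ⟨a, b, z, hza, hzb, ha, hb⟩)
    · obtain ⟨s, rfl, rfl⟩ := inL_eq_iota h hb.symm
      cases inL_injective h ha
      exact ⟨s, hab, le_rfl⟩
    · obtain ⟨s, rfl, rfl⟩ := inL_eq_iota h ha
      cases iota_injective h hb
      exact ⟨s, le_rfl, hab⟩
    · obtain ⟨s, rfl, rfl⟩ := inL_eq_iota h ha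
      obtain ⟨t, rfl, rfl⟩ := inL_eq_iota h hb.symm
      refine ⟨t, (h.le_iff.2 ?_), le_rfl⟩
      rw [h.le_iff] at hza hzb
      exact (compl_le_iff.1 hza).trans hzb
  · rintro ⟨z, hx, hy⟩
    by_cases hz : z = ⊤
    · subst hz
      rw [compl_top', map_bot, le_bot_iff] at hy
      subst hy
      rw [iota_bot, rel_inL_inL]
      exact le_top
    · obtain ⟨s, rfl⟩ := h.downward z hz x hx
      rw [h.le_iff] at hx
      rw [← Ortholattice.compl_compl' s, ← iota_apply, rel_iota_iota]
      exact hy.trans (h.le_iff.2 (compl_le_iff.2 hx))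

theorem rel_trans (h : IsTriExt e) {a b c : Ortho h} (hab : Rel h a b) (hbc : Rel h b c) :
    Rel h a c := by
  rcases exists_rep h a with ⟨x, rfl⟩ | ⟨x, rfl⟩ <;>
  rcases exists_rep h b with ⟨y, rfl⟩ | ⟨y, rfl⟩ <;>
  rcases exists_rep h c with ⟨t, rfl⟩ | ⟨t, rfl⟩ <;>
  simp only [rel_inL_inL, rel_iota_inL, rel_iota_iota, rel_inL_iota] at *
  · exact hab.trans hbc
  · obtain ⟨z, h1, h2⟩ := hbc
    exact ⟨z, hab.trans h1, h2⟩
  · obtain ⟨z, h1, h2⟩ := hab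
    obtain ⟨w, h3, h4⟩ := hbc
    exact (h1.trans (h.le_iff.2 (compl_le_iff.1 (h.le_iff.1 (h3.trans h2))))).trans h4
  · obtain ⟨z, h1, h2⟩ := hab
    exact ⟨z, h1, hbc.trans h2⟩
  · obtain ⟨z, h1, h2⟩ := hab
    exact ⟨z, h1, h2.trans hbc⟩
  · obtain ⟨z, h1, h2⟩ := hab
    obtain ⟨w, h3, h4⟩ := hbc
    exact (h4.trans (h.le_iff.2 (compl_le_iff.2 (h.le_iff.1 (h2.trans h3))))).trans h1
  · obtain ⟨z, h1, h2⟩ := hbc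
    exact ⟨z, h1.trans hab, h2⟩
  · exact hbc.trans hab

theorem le_iff_rel (h : IsTriExt e) {a b : Ortho h} : a ≤ b ↔ Rel h a b := by
  constructor
  · intro hab
    change Relation.TransGen _ a b at hab
    induction hab with
    | single h1 => exact h1.imp id Or.inl
    | tail _ h1 ih => exact rel_trans h ih (h1.imp id Or.inl)
  · rintro (h1 | h1 | ⟨x, y, z, hx, hy, rfl, rfl⟩)
    · exact .single (Or.inl h1)
    · exact .single (Or.inr h1)
    · refine .tail (.single (Or.inr ⟨x, e zᶜ, hx, rfl, rfl⟩)) (Or.inl ⟨e z, y, hy, ?_, rfl⟩)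
      rw [iota_apply, Ortholattice.compl_compl']

theorem inL_le_inL (h : IsTriExt e) {x y : L₁} : inL h x ≤ inL h y ↔ x ≤ y := by
  rw [le_iff_rel, rel_inL_inL]

theorem iota_le_inL (h : IsTriExt e) {x y : L₁} :
    iota h x ≤ inL h y ↔ ∃ z, e zᶜ ≤ x ∧ e z ≤ y := by
  rw [le_iff_rel, rel_iota_inL]

theorem iota_le_iota (h : IsTriExt e) {x y : L₁} : iota h x ≤ iota h y ↔ y ≤ x := by
  rw [le_iff_rel, rel_iota_iota]

theorem inL_le_iota (h : IsTriExt e) {x y : L₁} :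
    inL h x ≤ iota h y ↔ ∃ z, x ≤ e z ∧ y ≤ e zᶜ := by
  rw [le_iff_rel, rel_inL_iota]

instance (h : IsTriExt e) : PartialOrder (Ortho h) where
  le_refl a := by
    rcases exists_rep h a with ⟨x, rfl⟩ | ⟨x, rfl⟩
    · rw [inL_le_inL]
    · rw [iota_le_iota]
  le_trans _ _ _ hab hbc := Relation.TransGen.trans hab hbc
  le_antisymm a b hab hba := by
    rcases exists_rep h a with ⟨x, rfl⟩ | ⟨x, rfl⟩ <;>
    rcases exists_rep h b with ⟨y, rfl⟩ | ⟨y, rfl⟩ <;>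
    simp only [inL_le_inL, iota_le_inL, iota_le_iota, inL_le_iota] at *
    · rw [le_antisymm hab hba]
    · obtain ⟨z, h1, h2⟩ := hab
      obtain ⟨w, h3, h4⟩ := hba
      have e1 := h.le_iff.1 (h4.trans h1)
      have e2 := compl_le_iff.1 (h.le_iff.1 (h3.trans h2))
      obtain rfl := le_antisymm e1 e2
      rw [le_antisymm h1 h4, le_antisymm h2 h3, iota_apply, Ortholattice.compl_compl']
    · obtain ⟨z, h1, h2⟩ := hba
      obtain ⟨w, h3, h4⟩ := hab
      have e1 := h.le_iff.1 (h4.trans h1)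
      have e2 := compl_le_iff.1 (h.le_iff.1 (h3.trans h2))
      obtain rfl := le_antisymm e1 e2
      rw [le_antisymm h1 h4, le_antisymm h2 h3, iota_apply, Ortholattice.compl_compl']
    · rw [le_antisymm hab hba]

theorem perp_le_perp (h : IsTriExt e) {a b : Ortho h} (hab : a ≤ b) :
    perp h b ≤ perp h a := by
  rcases exists_rep h a with ⟨x, rfl⟩ | ⟨x, rfl⟩ <;>
  rcases exists_rep h b with ⟨y, rfl⟩ | ⟨y, rfl⟩ <;>
  simp only [perp_inL, perp_iota, inL_le_inL, iota_le_inL, iota_le_iota, inL_le_iota] at *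
  · exact hab
  · obtain ⟨z, h1, h2⟩ := hab
    exact ⟨zᶜ, h2, by rwa [Ortholattice.compl_compl']⟩
  · obtain ⟨z, h1, h2⟩ := hab
    exact ⟨zᶜ, by rwa [Ortholattice.compl_compl'], h1⟩
  · exact hab

theorem isGLB_inL_inL (h : IsTriExt e) (x y : L₁) :
    IsGLB {inL h x, inL h y} (inL h (x ⊓ y)) := by
  refine ⟨?_, fun c hc => ?_⟩
  · rintro _ (rfl | rfl)
    · exact (inL_le_inL h).2 inf_le_left
    · exact (inL_le_inL h).2 inf_le_right
  · have h1 := hc (Set.mem_insert _ _)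
    have h2 := hc (Set.mem_insert_of_mem _ rfl)
    rcases exists_rep h c with ⟨t, rfl⟩ | ⟨t, rfl⟩
    · rw [inL_le_inL] at *
      exact le_inf h1 h2
    · rw [iota_le_inL] at *
      obtain ⟨z, h3, h4⟩ := h1
      obtain ⟨w, h5, h6⟩ := h2
      have hp := h.proj_spec t
      have h7 : (z ⊓ w)ᶜ ≤ h.proj t := compl_inf_le (hp.2 h3) (hp.2 h5)
      refine ⟨z ⊓ w, (h.le_iff.2 h7).trans hp.1, ?_⟩
      rw [map_inf]
      exact inf_le_inf h4 h6

theorem isGLB_iota_iota (h : IsTriExt e) (x y : L₁) :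
    IsGLB {iota h x, iota h y} (iota h (x ⊔ y)) := by
  refine ⟨?_, fun c hc => ?_⟩
  · rintro _ (rfl | rfl)
    · exact (iota_le_iota h).2 le_sup_left
    · exact (iota_le_iota h).2 le_sup_right
  · have h1 := hc (Set.mem_insert _ _)
    have h2 := hc (Set.mem_insert_of_mem _ rfl)
    rcases exists_rep h c with ⟨t, rfl⟩ | ⟨t, rfl⟩
    · rw [inL_le_iota] at *
      obtain ⟨z, h3, h4⟩ := h1
      obtain ⟨w, h5, h6⟩ := h2
      refine ⟨z ⊓ w, by rw [map_inf]; exact le_inf h3 h5, sup_le ?_ ?_⟩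
      · exact h4.trans (h.le_iff.2 (compl_le_iff.2 inf_le_left))
      · exact h6.trans (h.le_iff.2 (compl_le_iff.2 inf_le_right))
    · rw [iota_le_iota] at *
      exact sup_le h1 h2

theorem isGLB_inL_iota (h : IsTriExt e) (x y : L₁) (hy : y ∉ Set.range e) :
    IsGLB {inL h x, iota h y} (iota h (e (h.proj x)ᶜ ⊔ y)) := by
  have hp := h.proj_spec x
  refine ⟨?_, fun c hc => ?_⟩
  · rintro _ (rfl | rfl)
    · exact (iota_le_inL h).2 ⟨_, le_sup_left, hp.1⟩
    · exact (iota_le_iota h).2 le_sup_right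
  · have h1 := hc (Set.mem_insert _ _)
    have h2 := hc (Set.mem_insert_of_mem _ rfl)
    rcases exists_rep h c with ⟨t, rfl⟩ | ⟨t, rfl⟩
    · rw [inL_le_inL] at h1
      rw [inL_le_iota] at *
      obtain ⟨z, h3, h4⟩ := h2
      have hz : z ≠ ⊤ := by
        rintro rfl
        rw [compl_top', map_bot, le_bot_iff] at h4
        exact hy ⟨⊥, by rw [h4, map_bot]⟩
      obtain ⟨s, rfl⟩ := h.downward z hz t h3
      refine ⟨s, le_rfl, sup_le (h.le_iff.2 (compl_le_iff.2 (hp.2 h1))) ?_⟩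
      exact h4.trans (h.le_iff.2 (compl_le_iff.2 (h.le_iff.1 h3)))
    · rw [iota_le_inL] at h1
      rw [iota_le_iota] at *
      obtain ⟨z, h3, h4⟩ := h1
      exact sup_le ((h.le_iff.2 (compl_le_iff.2 (hp.2 h4))).trans h3) h2

/-- The meet of `ortho(L₁, L₀)`: the meet of `L₁` on `L₁`, the meet of `L₂` on `L₂`, and
`π(x) ⊓₂ y` for `x ∈ L₁`, `y ∈ L₂ \ L₀`. -/
noncomputable def meet (h : IsTriExt e) : Ortho h → Ortho h → Ortho h
  | .ofL₁ x, .ofL₁ y => inL h (x ⊓ y)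
  | .ofL₁ x, .copy y => iota h (e (h.proj x)ᶜ ⊔ y.1)
  | .copy y, .ofL₁ x => iota h (e (h.proj x)ᶜ ⊔ y.1)
  | .copy x, .copy y => iota h (x.1 ⊔ y.1)

theorem isGLB_meet (h : IsTriExt e) (a b : Ortho h) : IsGLB {a, b} (meet h a b) := by
  rcases a with x | ⟨x, hx⟩ <;> rcases b with y | ⟨y, hy⟩
  · exact isGLB_inL_inL h x y
  · have := isGLB_inL_iota h x y hy
    rwa [iota_of_notMem h hy] at this
  · have := isGLB_inL_iota h y x hx
    rwa [iota_of_notMem h hx, Set.pair_comm] at this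
  · have := isGLB_iota_iota h x y
    rwa [iota_of_notMem h hx, iota_of_notMem h hy] at this

theorem meet_le_left (h : IsTriExt e) (a b : Ortho h) : meet h a b ≤ a :=
  (isGLB_meet h a b).1 (Set.mem_insert _ _)

theorem meet_le_right (h : IsTriExt e) (a b : Ortho h) : meet h a b ≤ b :=
  (isGLB_meet h a b).1 (Set.mem_insert_of_mem _ rfl)

theorem le_meet (h : IsTriExt e) {a b c : Ortho h} (hb : a ≤ b) (hc : a ≤ c) :
    a ≤ meet h b c :=
  (isGLB_meet h b c).2 (by rintro _ (rfl | rfl) <;> assumption)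

theorem le_inL_top (h : IsTriExt e) (a : Ortho h) : a ≤ inL h ⊤ := by
  rcases exists_rep h a with ⟨x, rfl⟩ | ⟨x, rfl⟩
  · exact (inL_le_inL h).2 le_top
  · rw [← iota_bot]
    exact (iota_le_iota h).2 bot_le

theorem inL_bot_le (h : IsTriExt e) (a : Ortho h) : inL h ⊥ ≤ a := by
  rcases exists_rep h a with ⟨x, rfl⟩ | ⟨x, rfl⟩
  · exact (inL_le_inL h).2 bot_le
  · rw [← iota_top]
    exact (iota_le_iota h).2 le_top

theorem eq_top_of_inL_le_of_iota_le (h : IsTriExt e) {x : L₁} {b : Ortho h}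
    (h1 : inL h x ≤ b) (h2 : iota h x ≤ b) : b = inL h ⊤ := by
  rcases exists_rep h b with ⟨y, rfl⟩ | ⟨y, rfl⟩
  · rw [inL_le_inL] at h1
    rw [iota_le_inL] at h2
    obtain ⟨z, h3, h4⟩ := h2
    have h5 : e (z ⊔ zᶜ) ≤ y := by
      rw [map_sup]
      exact sup_le h4 (h3.trans h1)
    rw [Ortholattice.sup_compl', map_top, top_le_iff] at h5
    rw [h5]
  · rw [inL_le_iota] at h1
    rw [iota_le_iota] at h2
    obtain ⟨z, h3, h4⟩ := h1
    have h5 : y ≤ e (z ⊓ zᶜ) := by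
      rw [map_inf]
      exact le_inf (h2.trans h3) h4
    rw [Ortholattice.inf_compl', map_bot, le_bot_iff] at h5
    rw [h5, iota_bot]

theorem eq_top_of_le (h : IsTriExt e) {a b : Ortho h} (h1 : a ≤ b) (h2 : perp h a ≤ b) :
    b = inL h ⊤ := by
  rcases exists_rep h a with ⟨x, rfl⟩ | ⟨x, rfl⟩
  · exact eq_top_of_inL_le_of_iota_le h h1 (by rwa [perp_inL] at h2)
  · exact eq_top_of_inL_le_of_iota_le h (by rwa [perp_iota] at h2) h1

/-- The ortholattice `ortho(L₁, L₀)`. -/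
noncomputable instance instOrtholattice (h : IsTriExt e) : Ortholattice (Ortho h) where
  inf := meet h
  inf_le_left := meet_le_left h
  inf_le_right := meet_le_right h
  le_inf _ _ _ := le_meet h
  sup a b := perp h (meet h (perp h a) (perp h b))
  le_sup_left a b := by
    have := perp_le_perp h (meet_le_left h (perp h a) (perp h b))
    rwa [perp_perp] at this
  le_sup_right a b := by
    have := perp_le_perp h (meet_le_right h (perp h a) (perp h b))
    rwa [perp_perp] at this
  sup_le a b c hac hbc := by
    have := perp_le_perp h (le_meet h (perp_le_perp h hac) (perp_le_perp h hbc))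
    rwa [perp_perp] at this
  top := inL h ⊤
  le_top := le_inL_top h
  bot := inL h ⊥
  bot_le := inL_bot_le h
  compl := perp h
  compl_le_compl' _ _ := perp_le_perp h
  compl_compl' := perp_perp h
  sup_compl' a := by
    change perp h (meet h (perp h a) (perp h (perp h a))) = inL h ⊤
    refine eq_top_of_le h (a := a) ?_ ?_
    · have := perp_le_perp h (meet_le_left h (perp h a) (perp h (perp h a)))
      rwa [perp_perp h a] at this ⊢
    · exact perp_le_perp h ((meet_le_right h _ _).trans (perp_perp h a).le)
  inf_compl' a := by
    change meet h a (perp h a) = inL h ⊥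
    rw [← perp_perp h (meet h a (perp h a))]
    have : perp h (meet h a (perp h a)) = inL h ⊤ := by
      refine eq_top_of_le h (a := a) ?_ ?_
      · have := perp_le_perp h (meet_le_right h a (perp h a))
        rwa [perp_perp] at this
      · exact perp_le_perp h (meet_le_left h a (perp h a))
    rw [this, perp_inL, iota_top]

/-- The inclusion of `L₀` into `ortho(L₁, L₀)`. -/
def base (h : IsTriExt e) (z : L₀) : Ortho h := inL h (e z)

end Ortho

end OrthoConstruction

/-!
Every operation of `L` becomes an orthopolynomial in a suitable `ortho(L₁, L)` for the
following reason. The pairs of literals `(x, xᶜ)` form an antichain in `L × L`, so an arbitrary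
function of `x` is a monotone function of its literals, and monotone functions can be
interpolated by *lattice* polynomials in an extension of `L`. The extension `L₁` used here,
`ClosedPair L κ`, consists of pairs `(w, B)` of an element `w` of `L` and a set `B` of formal
symbols subject to closure rules. For an operation `f` of arity `n` there are a flag for each of
the `2n` literals, a point for each `x : Fin n → L`, and an output flag. A literal flag together
with an element `w` above that literal of `x` forces the point `x`; the output flag together with the
point `x` forces `w ≥ f x`. Hence the meet of all `flag ⊔ literal` with the set of all points
is the single point `x` (`inf_flagAt_inf_points`), whose join with the output flag has first
component `f x` (`points_sup_outAt`). This value still contains symbols; running two disjoint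
copies of the construction and meeting the results leaves exactly `f x`
(`interp_inf_interp`). Closed pairs form a complete lattice `L₁` with `L ⊴ L₁`, the projection
being the first component.

Power closedness is arranged by further symbols: every lattice of size at most `κ` is embedded
in `L₁` through its principal ideals (`idealHom`), so that `S × S` occurs as a sublattice
whenever `S` has size at most `κ`.

For the second part the extension is iterated along the ordinal `μ = max(κ, ℵ₀)⁺`, in the category
`CompleteOL` of complete ortholattices and convex embeddings. Directed unions exist there: if a
set has a nonzero element and a proper upper bound, both lie in one stage, and convexity of that
stage allows the supremum to be computed in it (`Lim.isCompleteOrder`). Since `μ` is regular,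
a set of at most `κ` points and the values of `f` on it lie in one stage, where `f` is interpolated
with coefficients from the next stage.
-/

/-! ### Completeness and the basic properties of `ortho(L₁, L₀)` -/

theorem isCompleteOrder_of_isGLB {α : Type u} [PartialOrder α]
    (h : ∀ s : Set α, ∃ b, IsGLB s b) : IsCompleteOrder α := fun s =>
  ⟨(h (upperBounds s)).imp fun _ => isGLB_upperBounds.1, h s⟩

namespace Ortholattice

variable {α : Type u} [Ortholattice α]

theorem le_compl_comm {x y : α} : x ≤ yᶜ ↔ y ≤ xᶜ := by
  rw [← Ortho.compl_le_iff, compl_compl']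

theorem isGLB_compl_image {s : Set α} {a : α} (h : IsLUB s a) :
    IsGLB ((fun x => xᶜ) '' s) aᶜ := by
  refine ⟨?_, fun b hb => le_compl_comm.2 (h.2 fun x hx => le_compl_comm.2 (hb ⟨x, hx, rfl⟩))⟩
  rintro _ ⟨x, hx, rfl⟩
  exact compl_le_compl' _ _ (h.1 hx)

/-- Orthocomplementation exchanges suprema and infima, so suprema suffice for
completeness. -/
theorem isCompleteOrder_of_isLUB (h : ∀ s : Set α, ∃ a, IsLUB s a) : IsCompleteOrder α := by
  refine isCompleteOrder_of_isGLB fun s => ?_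
  obtain ⟨a, ha⟩ := h ((fun x => xᶜ) '' s)
  refine ⟨aᶜ, ?_⟩
  have := isGLB_compl_image ha
  simpa [Set.image_image, compl_compl'] using this

end Ortholattice

namespace IsOrthoEmbedding

variable {α : Type u} {β : Type v} {γ : Type w} [Ortholattice α] [Ortholattice β]
  [Ortholattice γ] {j : α → β} {k : β → γ}

theorem id : IsOrthoEmbedding (_root_.id : α → α) :=
  ⟨Function.injective_id, fun _ _ => rfl, fun _ _ => rfl, rfl, rfl, fun _ => rfl⟩

theorem comp (hk : IsOrthoEmbedding k) (hj : IsOrthoEmbedding j) : IsOrthoEmbedding (k ∘ j) where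
  injective := hk.injective.comp hj.injective
  map_sup x y := by simp [hj.map_sup, hk.map_sup]
  map_inf x y := by simp [hj.map_inf, hk.map_inf]
  map_bot := by simp [hj.map_bot, hk.map_bot]
  map_top := by simp [hj.map_top, hk.map_top]
  map_compl x := by simp [hj.map_compl, hk.map_compl]

theorem le_iff (hj : IsOrthoEmbedding j) {x y : α} : j x ≤ j y ↔ x ≤ y := by
  rw [← inf_eq_left, ← hj.map_inf, hj.injective.eq_iff, inf_eq_left]

theorem bot_lt_iff (hj : IsOrthoEmbedding j) {x : α} : ⊥ < j x ↔ ⊥ < x := by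
  rw [bot_lt_iff_ne_bot, bot_lt_iff_ne_bot, ← hj.map_bot, hj.injective.ne_iff]

theorem lt_top_iff (hj : IsOrthoEmbedding j) {x : α} : j x < ⊤ ↔ x < ⊤ := by
  rw [lt_top_iff_ne_top, lt_top_iff_ne_top, ← hj.map_top, hj.injective.ne_iff]

end IsOrthoEmbedding

namespace Ortho

variable {L₀ : Type u} {L₁ : Type v} [Ortholattice L₀] [Lattice L₁] [BoundedOrder L₁]
  {e : BoundedLatticeHom L₀ L₁}

theorem inL_sup (h : IsTriExt e) (x y : L₁) : inL h (x ⊔ y) = inL h x ⊔ inL h y := by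
  have h1 : meet h (iota h x) (iota h y) = iota h (x ⊔ y) :=
    (isGLB_meet h _ _).unique (isGLB_iota_iota h x y)
  change _ = perp h (meet h (iota h x) (iota h y))
  rw [h1, perp_iota]

/-- The inclusion of `L₁` into `ortho(L₁, L₀)` as a homomorphism of bounded lattices. -/
noncomputable def inLHom (h : IsTriExt e) : BoundedLatticeHom L₁ (Ortho h) where
  toFun := inL h
  map_sup' := inL_sup h
  map_inf' _ _ := rfl
  map_top' := rfl
  map_bot' := rfl

theorem base_compl (h : IsTriExt e) (z : L₀) : base h zᶜ = (base h z)ᶜ :=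
  (iota_apply h z).symm

theorem isOrthoEmbedding_base (h : IsTriExt e) : IsOrthoEmbedding (base h) where
  injective := (inL_injective h).comp h.injective
  map_sup x y := by simp only [base, map_sup, inL_sup]
  map_inf x y := by simp only [base, map_inf]; rfl
  map_bot := by simp only [base, map_bot]; rfl
  map_top := by simp only [base, map_top]; rfl
  map_compl := base_compl h

theorem isConvexIn_range_base (h : IsTriExt e) : IsConvexIn (Set.range (base h)) := by
  rintro _ ⟨z, rfl⟩ _ ⟨z', rfl⟩ a hz hza haz' hz'
  rw [(isOrthoEmbedding_base h).bot_lt_iff] at hz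
  rw [(isOrthoEmbedding_base h).lt_top_iff] at hz'
  rcases exists_rep h a with ⟨x, rfl⟩ | ⟨x, rfl⟩
  · obtain ⟨t, rfl⟩ := h.downward z' hz'.ne x ((inL_le_inL h).1 haz')
    exact ⟨t, rfl⟩
  · have h2 : x ≤ e zᶜ := by
      rw [← iota_le_iota h, iota_apply, Ortholattice.compl_compl']
      exact hza
    have h3 : zᶜ ≠ ⊤ := fun h4 => hz.ne' (by
      rw [← Ortholattice.compl_compl' z, h4, compl_top'])
    obtain ⟨t, rfl⟩ := h.downward _ h3 x h2
    exact ⟨tᶜ, (iota_apply h t).symm⟩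

/-- The infimum of `inL X ∪ iota Y` is `iota (π(⋀ X)ᶜ ⊔ ⋁ Y)` as soon as `Y` reaches outside
`L₀`; otherwise the whole set lies in `L₁` and has its infimum there. -/
theorem isCompleteOrder (h : IsTriExt e) (hL : IsCompleteOrder L₁) :
    IsCompleteOrder (Ortho h) := by
  refine isCompleteOrder_of_isGLB fun s => ?_
  by_cases hs : s ⊆ Set.range (inL h)
  · obtain ⟨X, rfl⟩ := Set.subset_range_iff_exists_image_eq.1 hs
    obtain ⟨-, m, hm⟩ := hL X
    refine ⟨inL h m, ?_, fun c hc => ?_⟩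
    · rintro _ ⟨x, hx, rfl⟩
      exact (inL_le_inL h).2 (hm.1 hx)
    · rcases exists_rep h c with ⟨t, rfl⟩ | ⟨t, rfl⟩
      · exact (inL_le_inL h).2 (hm.2 fun x hx => (inL_le_inL h).1 (hc ⟨x, hx, rfl⟩))
      · have hp := h.proj_spec t
        refine (iota_le_inL h).2 ⟨(h.proj t)ᶜ, by rw [Ortholattice.compl_compl']; exact hp.1,
          hm.2 fun x hx => ?_⟩
        obtain ⟨z, h1, h2⟩ := (iota_le_inL h).1 (hc ⟨x, hx, rfl⟩)
        refine le_trans (h.le_iff.2 ?_) h2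
        rw [← compl_le_iff, Ortholattice.compl_compl']
        exact hp.2 h1
  · obtain ⟨a, has, ha⟩ := Set.not_subset.1 hs
    obtain ⟨y₀, rfl⟩ : ∃ y, a = iota h y :=
      (exists_rep h a).resolve_left fun ⟨x, hx⟩ => ha ⟨x, hx.symm⟩
    obtain ⟨-, m, hm⟩ := hL {x | inL h x ∈ s}
    obtain ⟨⟨n, hn⟩, -⟩ := hL {y | iota h y ∈ s}
    have hp := h.proj_spec m
    refine ⟨iota h (e (h.proj m)ᶜ ⊔ n), fun b hb => ?_, fun c hc => ?_⟩
    · rcases exists_rep h b with ⟨x, rfl⟩ | ⟨y, rfl⟩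
      · exact (iota_le_inL h).2 ⟨h.proj m, le_sup_left, hp.1.trans (hm.1 hb)⟩
      · exact (iota_le_iota h).2 ((hn.1 hb).trans le_sup_right)
    · rcases exists_rep h c with ⟨t, rfl⟩ | ⟨t, rfl⟩
      · obtain ⟨z, h3, h4⟩ := (inL_le_iota h).1 (hc has)
        -- `y₀ ∉ L₀`, so the interpolant `z` is not `⊤`, and `t` lies in `L₀`
        have hz : z ≠ ⊤ := by
          rintro rfl
          rw [compl_top', map_bot, le_bot_iff] at h4
          exact ha ⟨⊤, by rw [h4, iota_bot]⟩
        obtain ⟨t, rfl⟩ := h.downward z hz t h3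
        have h5 : e t ≤ m := hm.2 fun x hx => (inL_le_inL h).1 (hc hx)
        refine (inL_le_iota h).2 ⟨t, le_rfl, sup_le
          (h.le_iff.2 (compl_le_iff.2 (hp.2 h5))) (hn.2 fun y hy => ?_)⟩
        obtain ⟨w, h6, h7⟩ := (inL_le_iota h).1 (hc hy)
        exact h7.trans (h.le_iff.2 (compl_le_iff.2 (h.le_iff.1 h6)))
      · have ht := h.proj_spec t
        refine (iota_le_iota h).2 (sup_le ?_ (hn.2 fun y hy => (iota_le_iota h).1 (hc hy)))
        refine le_trans (h.le_iff.2 ?_) ht.1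
        rw [← compl_le_iff, Ortholattice.compl_compl']
        refine hp.2 (hm.2 fun x hx => ?_)
        obtain ⟨z, h1, h2⟩ := (iota_le_inL h).1 (hc hx)
        refine le_trans (h.le_iff.2 ?_) h2
        rw [← compl_le_iff, Ortholattice.compl_compl']
        exact ht.2 h1

end Ortho

/-! ### The lattice of closed pairs -/

/-- The data of one interpolation problem: an operation of some finite arity on `L`, and a
Boolean label providing two disjoint copies of each operation. -/
structure OpIndex (L : Type u) : Type u where
  copy : Bool
  arity : ℕ
  op : (Fin arity → L) → L

/-- A lattice whose carrier is a subset of one fixed set of size `κ`. Up to isomorphism these are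
all the lattices of cardinality at most `κ`, and they form a small type. -/
structure SmallLattice (κ : Cardinal.{u}) : Type u where
  carrier : Set κ.out
  str : Lattice carrier

instance (κ : Cardinal.{u}) (A : SmallLattice κ) : Lattice A.carrier := A.str

/-- The symbols from which the new elements over `L` are made. -/
inductive Symb (L : Type u) (κ : Cardinal.{u}) : Type u
  /-- The flag of the literal `x k` (for `s = true`) or `(x k)ᶜ` (for `s = false`). -/
  | flag (i : OpIndex L) (k : Fin i.arity) (s : Bool)
  /-- The point `x` of the domain of the operation `i`. -/
  | pt (i : OpIndex L) (x : Fin i.arity → L)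
  /-- The flag under which points release the values of the operation `i`. -/
  | out (i : OpIndex L)
  /-- The element `q` of a small lattice. -/
  | lat (A : SmallLattice κ) (q : A.carrier)

section ClosedPairs

variable {L : Type u} [Ortholattice L] {κ : Cardinal.{u}}

/-- The literals: `x k`, and `(x k)ᶜ`. -/
def lit {n : ℕ} (x : Fin n → L) (k : Fin n) (s : Bool) : L := if s then x k else (x k)ᶜ

theorem eq_of_lit_le {n : ℕ} {x y : Fin n → L} (h : ∀ k s, lit y k s ≤ lit x k s) : y = x := by
  funext k
  exact le_antisymm (h k true) (Ortho.compl_le_iff.1 (h k false))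

/-- Closedness of a pair `(w, B)`: a flag together with its literal produces points, points
produce values, and small lattices are represented by their ideals. Requiring all symbols at
`w = ⊤` makes the top of `L` the top of the lattice of closed pairs. -/
structure IsClosedPair (w : L) (B : Set (Symb L κ)) : Prop where
  top : w = ⊤ → ∀ g, g ∈ B
  pt : ∀ i k s x, Symb.flag i k s ∈ B → lit x k s ≤ w → Symb.pt i x ∈ B
  out : ∀ i x, Symb.out i ∈ B → Symb.pt i x ∈ B → i.op x ≤ w
  sup : ∀ A q q', Symb.lat A q ∈ B → Symb.lat A q' ∈ B → Symb.lat A (q ⊔ q') ∈ B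
  down : ∀ A q q', q' ≤ q → Symb.lat A q ∈ B → Symb.lat A q' ∈ B

variable (L κ) in
/-- The closed pairs, ordered componentwise. -/
structure ClosedPair : Type u where
  fst : L
  snd : Set (Symb L κ)
  closed : IsClosedPair fst snd

namespace ClosedPair

theorem ext' {p q : ClosedPair L κ} (h1 : p.fst = q.fst) (h2 : p.snd = q.snd) : p = q := by
  cases p; cases q; cases h1; cases h2; rfl

instance : PartialOrder (ClosedPair L κ) where
  le p q := p.fst ≤ q.fst ∧ p.snd ⊆ q.snd
  le_refl p := ⟨le_rfl, subset_rfl⟩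
  le_trans p q r h1 h2 := ⟨h1.1.trans h2.1, h1.2.trans h2.2⟩
  le_antisymm p q h1 h2 := ext' (le_antisymm h1.1 h2.1) (subset_antisymm h1.2 h2.2)

theorem le_def {p q : ClosedPair L κ} : p ≤ q ↔ p.fst ≤ q.fst ∧ p.snd ⊆ q.snd := Iff.rfl

/-- The componentwise meet. -/
def meet (p q : ClosedPair L κ) : ClosedPair L κ where
  fst := p.fst ⊓ q.fst
  snd := p.snd ∩ q.snd
  closed :=
    { top := fun h g => ⟨p.closed.top (top_le_iff.1 (h.ge.trans inf_le_left)) g,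
        q.closed.top (top_le_iff.1 (h.ge.trans inf_le_right)) g⟩
      pt := fun i k s x h1 h2 => ⟨p.closed.pt i k s x h1.1 (h2.trans inf_le_left),
        q.closed.pt i k s x h1.2 (h2.trans inf_le_right)⟩
      out := fun i x h1 h2 => le_inf (p.closed.out i x h1.1 h2.1) (q.closed.out i x h1.2 h2.2)
      sup := fun A a b h1 h2 => ⟨p.closed.sup A a b h1.1 h2.1, q.closed.sup A a b h1.2 h2.2⟩
      down := fun A a b h h1 => ⟨p.closed.down A a b h h1.1, q.closed.down A a b h h1.2⟩ }

theorem exists_isGLB (hL : IsCompleteOrder L) (s : Set (ClosedPair L κ)) :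
    ∃ b, IsGLB s b := by
  obtain ⟨-, w, hw⟩ := hL (fst '' s)
  have hle : ∀ p ∈ s, w ≤ p.fst := fun p hp => hw.1 ⟨p, hp, rfl⟩
  refine ⟨⟨w, {g | ∀ p ∈ s, g ∈ p.snd}, ?_⟩, fun p hp => ⟨hle p hp, fun g hg => hg p hp⟩,
    fun q hq => ⟨hw.2 ?_, fun g hg p hp => (hq hp).2 hg⟩⟩
  · refine ⟨fun h g p hp => ?_, fun i k s x h1 h2 p hp => ?_, fun i x h1 h2 => hw.2 ?_,
      fun A a b h1 h2 p hp => ?_, fun A a b h h1 p hp => ?_⟩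
    · exact p.closed.top (top_le_iff.1 (h.ge.trans (hle p hp))) g
    · exact p.closed.pt i k s x (h1 p hp) (h2.trans (hle p hp))
    · rintro _ ⟨p, hp, rfl⟩
      exact p.closed.out i x (h1 p hp) (h2 p hp)
    · exact p.closed.sup A a b (h1 p hp) (h2 p hp)
    · exact p.closed.down A a b h (h1 p hp)
  · rintro _ ⟨p, hp, rfl⟩
    exact (hq hp).1

theorem isCompleteOrder (hL : IsCompleteOrder L) : IsCompleteOrder (ClosedPair L κ) :=
  isCompleteOrder_of_isGLB (exists_isGLB hL)

/-- The lattice of closed pairs; the join is the closure of the componentwise join. -/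
noncomputable instance [hL : Fact (IsCompleteOrder L)] : Lattice (ClosedPair L κ) where
  inf := meet
  inf_le_left _ _ := ⟨inf_le_left, Set.inter_subset_left⟩
  inf_le_right _ _ := ⟨inf_le_right, Set.inter_subset_right⟩
  le_inf _ _ _ h1 h2 := ⟨le_inf h1.1 h2.1, Set.subset_inter h1.2 h2.2⟩
  sup p q := (isCompleteOrder hL.out {p, q}).1.choose
  le_sup_left p q := (isCompleteOrder hL.out {p, q}).1.choose_spec.1 (Set.mem_insert _ _)
  le_sup_right p q :=
    (isCompleteOrder hL.out {p, q}).1.choose_spec.1 (Set.mem_insert_of_mem _ rfl)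
  sup_le p q r h1 h2 := (isCompleteOrder hL.out {p, q}).1.choose_spec.2
    (by rintro _ (rfl | rfl) <;> assumption)

/-- The pair with first component `w` whose second component is `B`, or everything if
`w = ⊤`. -/
def mk' (w : L) (B : Set (Symb L κ)) (h : w ≠ ⊤ → IsClosedPair w B) : ClosedPair L κ where
  fst := w
  snd := {g | w = ⊤ ∨ g ∈ B}
  closed := by
    by_cases hw : w = ⊤
    · simp only [hw, true_or, Set.ofPred_true]
      exact ⟨fun _ _ => trivial, fun _ _ _ _ _ _ => trivial, fun _ _ _ _ => le_top,
        fun _ _ _ _ _ => trivial, fun _ _ _ _ _ => trivial⟩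
    · simpa only [hw, false_or, Set.ofPred_mem_eq] using h hw

@[simp]
theorem fst_mk' (w : L) (B : Set (Symb L κ)) (h) : (mk' w B h).fst = w := rfl

theorem mk'_le {w : L} {B : Set (Symb L κ)} {h} {p : ClosedPair L κ} :
    mk' w B h ≤ p ↔ w ≤ p.fst ∧ B ⊆ p.snd := by
  refine ⟨fun hp => ⟨hp.1, fun g hg => hp.2 (Or.inr hg)⟩, fun hp => ⟨hp.1, ?_⟩⟩
  rintro g (rfl | hg)
  · exact p.closed.top (top_le_iff.1 hp.1) g
  · exact hp.2 hg

/-- The embedding of `L` into the lattice of closed pairs. -/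
def ofBase (w : L) : ClosedPair L κ :=
  mk' w ∅ fun hw => ⟨fun h => (hw h).elim, fun _ _ _ _ h => h.elim, fun _ _ h => h.elim,
    fun _ _ _ h => h.elim, fun _ _ _ _ h => h.elim⟩

@[simp]
theorem fst_ofBase (w : L) : (ofBase w : ClosedPair L κ).fst = w := rfl

theorem ofBase_le {w : L} {p : ClosedPair L κ} : ofBase w ≤ p ↔ w ≤ p.fst := by
  simp [ofBase, mk'_le]

instance : BoundedOrder (ClosedPair L κ) where
  top := ofBase ⊤
  le_top _ := ⟨le_top, fun _ _ => Or.inl rfl⟩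
  bot := ofBase ⊥
  bot_le _ := ofBase_le.2 bot_le

theorem snd_mono {p q : ClosedPair L κ} (h : p ≤ q) : p.snd ⊆ q.snd := h.2

variable [hL : Fact (IsCompleteOrder L)]

variable (L κ) in
/-- The inclusion of `L` as a homomorphism of bounded lattices. -/
noncomputable def baseHom : BoundedLatticeHom L (ClosedPair L κ) where
  toFun := ofBase
  map_sup' x y := le_antisymm
    (ofBase_le.2 (sup_le (ofBase_le.1 le_sup_left) (ofBase_le.1 le_sup_right)))
    (sup_le (ofBase_le.2 le_sup_left) (ofBase_le.2 le_sup_right))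
  map_inf' x y := ext' rfl <| by
    ext g
    change (x ⊓ y = ⊤ ∨ g ∈ (∅ : Set _)) ↔
      (x = ⊤ ∨ g ∈ (∅ : Set _)) ∧ (y = ⊤ ∨ g ∈ (∅ : Set _))
    simp
  map_top' := rfl
  map_bot' := rfl

variable (L κ) in
/-- `L ⊴ ClosedPair L κ`; the projection to `L` is the first component. -/
theorem isTriExt_baseHom : IsTriExt (baseHom L κ) where
  injective _ _ hxy := congrArg fst hxy
  exists_proj p := ⟨p.fst, ofBase_le.2 le_rfl, fun _ hz => ofBase_le.1 hz⟩
  downward _ hz p hp := ⟨p.fst, le_antisymm (ofBase_le.2 le_rfl)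
    ⟨le_rfl, fun _ hg => ((hp.2 hg).resolve_left hz).elim⟩⟩

/-! ### Interpolation by lattice polynomials -/

omit hL

/-- The element `w` together with a flag, and with the points which the two force. -/
def flagAt (i : OpIndex L) (k : Fin i.arity) (s : Bool) (w : L) : ClosedPair L κ :=
  mk' w {g | g = .flag i k s ∨ ∃ x, lit x k s ≤ w ∧ g = .pt i x} fun hw =>
    { top := fun h => (hw h).elim
      pt := by
        rintro _ _ _ x (h | ⟨_, _, h⟩) hx
        · cases h
          exact Or.inr ⟨x, hx, rfl⟩
        · cases h
      out := by rintro _ _ (h | ⟨_, _, h⟩) <;> cases h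
      sup := by rintro _ _ _ (h | ⟨_, _, h⟩) <;> cases h
      down := by rintro _ _ _ _ (h | ⟨_, _, h⟩) <;> cases h }

/-- A set of points of the operation `i`, over `⊥`. -/
def points (i : OpIndex L) (P : Set (Fin i.arity → L)) : ClosedPair L κ :=
  mk' ⊥ (.pt i '' P) fun hw =>
    { top := fun h => (hw h).elim
      pt := by rintro _ _ _ _ ⟨_, _, h⟩; cases h
      out := by rintro _ _ ⟨_, _, h⟩; cases h
      sup := by rintro _ _ _ ⟨_, _, h⟩; cases h
      down := by rintro _ _ _ _ ⟨_, _, h⟩; cases h }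

/-- The output flag of `i` together with the points in `P`, over any `w` bounding the values
of `i` on `P`. -/
def outAt (i : OpIndex L) (P : Set (Fin i.arity → L)) (w : L) (hP : ∀ x ∈ P, i.op x ≤ w) :
    ClosedPair L κ :=
  mk' w (insert (.out i) (.pt i '' P)) fun hw =>
    { top := fun h => (hw h).elim
      pt := by
        rintro _ _ _ _ (h | ⟨_, _, h⟩)
        · cases h
        · cases h
      out := by
        rintro _ x (h | ⟨_, _, h⟩)
        · cases h
          rintro (h | ⟨_, hx, h⟩)
          · cases h
          · cases h
            exact hP _ hx
        · cases h
      sup := by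
        rintro _ _ _ (h | ⟨_, _, h⟩)
        · cases h
        · cases h
      down := by
        rintro _ _ _ _ (h | ⟨_, _, h⟩)
        · cases h
        · cases h }

theorem mem_flagAt {i : OpIndex L} {k : Fin i.arity} {s : Bool} {w : L}
    {x : Fin i.arity → L} :
    Symb.pt i x ∈ (flagAt i k s w : ClosedPair L κ).snd ↔ lit x k s ≤ w := by
  constructor
  · rintro (rfl | h | ⟨y, hy, h⟩)
    · exact le_top
    · cases h
    · cases h
      exact hy
  · exact fun h => Or.inr (Or.inr ⟨x, h, rfl⟩)

include hL

theorem flagAt_bot_sup (i : OpIndex L) (k : Fin i.arity) (s : Bool) (w : L) :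
    (flagAt i k s ⊥ ⊔ ofBase w : ClosedPair L κ) = flagAt i k s w := by
  refine le_antisymm (sup_le (mk'_le.2 ⟨bot_le, ?_⟩) (ofBase_le.2 le_rfl))
    (mk'_le.2 ⟨ofBase_le.1 le_sup_right, ?_⟩)
  · rintro g (rfl | ⟨x, hx, rfl⟩)
    · exact Or.inr (Or.inl rfl)
    · exact Or.inr (Or.inr ⟨x, hx.trans bot_le, rfl⟩)
  · have h1 : Symb.flag i k s ∈ (flagAt i k s ⊥ ⊔ ofBase w : ClosedPair L κ).snd :=
      snd_mono (p := flagAt i k s ⊥) le_sup_left (Or.inr (Or.inl rfl))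
    rintro g (rfl | ⟨x, hx, rfl⟩)
    · exact h1
    · exact ClosedPair.closed _ |>.pt i k s x h1 (hx.trans (ofBase_le.1 le_sup_right))

/-- Since distinct points are separated by their literals, meeting the flags at the literals
of `x` singles out the point `x`. -/
theorem inf_flagAt_inf_points (i : OpIndex L) (x : Fin i.arity → L) :
    (Finset.univ.inf fun ks : Fin i.arity × Bool => flagAt i ks.1 ks.2 (lit x ks.1 ks.2)) ⊓
      points i Set.univ = (points i {x} : ClosedPair L κ) := by
  refine le_antisymm (le_def.2 ⟨inf_le_right, fun g hg => ?_⟩)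
    (le_inf (Finset.le_inf fun ks _ => ?_) ?_)
  · rcases hg.2 with h | ⟨y, -, rfl⟩
    · exact Or.inl h
    · refine Or.inr ⟨y, eq_of_lit_le fun k s => ?_, rfl⟩
      exact mem_flagAt.1
        (snd_mono (Finset.inf_le (Finset.mem_univ (k, s))) hg.1)
  · refine mk'_le.2 ⟨bot_le, ?_⟩
    rintro _ ⟨_, rfl, rfl⟩
    exact mem_flagAt.2 le_rfl
  · refine mk'_le.2 ⟨le_rfl, ?_⟩
    rintro _ ⟨y, -, rfl⟩
    exact Or.inr ⟨y, trivial, rfl⟩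

/-- The output flag turns the point `x` into the value of the operation at `x`, as a first
component. -/
theorem points_sup_outAt (i : OpIndex L) (x : Fin i.arity → L) :
    points i {x} ⊔ outAt i ∅ ⊥ (fun _ h => h.elim) =
      (outAt i {x} (i.op x) (by rintro _ rfl; exact le_rfl) : ClosedPair L κ) := by
  refine le_antisymm (sup_le (mk'_le.2 ⟨bot_le, ?_⟩) (mk'_le.2 ⟨bot_le, ?_⟩))
    (mk'_le.2 ?_)
  · rintro _ ⟨_, rfl, rfl⟩
    exact Or.inr (Or.inr ⟨_, rfl, rfl⟩)
  · rintro _ (rfl | ⟨_, h, -⟩)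
    · exact Or.inr (Or.inl rfl)
    · exact h.elim
  · set p : ClosedPair L κ := points i {x} ⊔ outAt i ∅ ⊥ (fun _ h => h.elim)
    have h1 : Symb.pt i x ∈ p.snd :=
      snd_mono (p := points i {x}) le_sup_left (Or.inr ⟨x, rfl, rfl⟩)
    have h2 : Symb.out i ∈ p.snd :=
      snd_mono (p := outAt i ∅ ⊥ (fun _ h => h.elim)) le_sup_right (Or.inr (Or.inl rfl))
    refine ⟨p.closed.out i x h2 h1, ?_⟩
    rintro _ (rfl | ⟨_, rfl, rfl⟩)
    · exact h2
    · exact h1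

/-- The two copies of an operation share no symbols, so that the meet of their outputs lies
in `L`. -/
theorem outAt_inf_outAt {n : ℕ} (f : (Fin n → L) → L) (x : Fin n → L) :
    (outAt ⟨true, n, f⟩ {x} (f x) (by rintro _ rfl; exact le_rfl) ⊓
      outAt ⟨false, n, f⟩ {x} (f x) (by rintro _ rfl; exact le_rfl) : ClosedPair L κ) =
      ofBase (f x) := by
  refine le_antisymm (le_def.2 ⟨inf_le_left, ?_⟩)
    (le_inf (ofBase_le.2 le_rfl) (ofBase_le.2 le_rfl))
  rintro g ⟨h | h | ⟨_, _, h⟩, h' | h' | ⟨_, _, h'⟩⟩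
  all_goals first
    | exact Or.inl h
    | exact Or.inl h'
    | (subst h; cases h')

/-- The lattice polynomial attached to the operation `i`, evaluated at `x`. -/
noncomputable def interp (i : OpIndex L) (x : Fin i.arity → L) : ClosedPair L κ :=
  ((Finset.univ.inf fun ks : Fin i.arity × Bool =>
    flagAt i ks.1 ks.2 ⊥ ⊔ ofBase (lit x ks.1 ks.2)) ⊓ points i Set.univ) ⊔
    outAt i ∅ ⊥ (fun _ h => h.elim)

theorem interp_eq_outAt (i : OpIndex L) (x : Fin i.arity → L) :
    (interp i x : ClosedPair L κ) =
      outAt i {x} (i.op x) (by rintro _ rfl; exact le_rfl) := by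
  simp only [interp, flagAt_bot_sup]
  rw [inf_flagAt_inf_points, points_sup_outAt]

theorem interp_inf_interp {n : ℕ} (f : (Fin n → L) → L) (x : Fin n → L) :
    (interp ⟨true, n, f⟩ x ⊓ interp ⟨false, n, f⟩ x : ClosedPair L κ) = ofBase (f x) := by
  rw [interp_eq_outAt ⟨true, n, f⟩ x, interp_eq_outAt ⟨false, n, f⟩ x]
  exact outAt_inf_outAt f x

/-! ### Small lattices as sublattices -/

omit hL in
/-- The principal ideal of `q` in the small lattice `A`, over `⊥`. -/
def ideal (A : SmallLattice κ) (q : A.carrier) : ClosedPair L κ :=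
  mk' ⊥ (.lat A '' {q' | q' ≤ q}) fun hw =>
    { top := fun h => (hw h).elim
      pt := by rintro _ _ _ _ ⟨_, _, h⟩; cases h
      out := by rintro _ _ ⟨_, _, h⟩; cases h
      sup := by
        rintro _ _ _ ⟨a, ha, h⟩
        cases h
        rintro ⟨b, hb, h⟩
        cases h
        exact ⟨_, sup_le ha hb, rfl⟩
      down := by
        rintro _ _ _ hle ⟨a, ha, h⟩
        cases h
        exact ⟨_, hle.trans ha, rfl⟩ }

variable (L) in
/-- The small lattice `A` inside the lattice of closed pairs. -/
noncomputable def idealHom (A : SmallLattice κ) : LatticeHom A.carrier (ClosedPair L κ) where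
  toFun := ideal A
  map_sup' a b := by
    refine le_antisymm (mk'_le.2 ⟨bot_le, ?_⟩)
      (sup_le (mk'_le.2 ⟨le_rfl, ?_⟩) (mk'_le.2 ⟨le_rfl, ?_⟩))
    · rintro _ ⟨q, hq, rfl⟩
      refine ClosedPair.closed _ |>.down A _ _ hq (ClosedPair.closed _ |>.sup A a b ?_ ?_)
      · exact snd_mono (p := ideal A a) le_sup_left (Or.inr ⟨a, le_refl a, rfl⟩)
      · exact snd_mono (p := ideal A b) le_sup_right (Or.inr ⟨b, le_refl b, rfl⟩)
    · rintro _ ⟨q, hq, rfl⟩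
      exact Or.inr ⟨q, le_trans hq le_sup_left, rfl⟩
    · rintro _ ⟨q, hq, rfl⟩
      exact Or.inr ⟨q, le_trans hq le_sup_right, rfl⟩
  map_inf' a b := by
    refine le_antisymm (mk'_le.2 ⟨bot_le, ?_⟩) ⟨inf_le_left, ?_⟩
    · rintro _ ⟨q, hq, rfl⟩
      exact ⟨Or.inr ⟨q, le_trans hq inf_le_left, rfl⟩, Or.inr ⟨q, le_trans hq inf_le_right, rfl⟩⟩
    · rintro g ⟨h | ⟨q, hq, h⟩, h' | ⟨q', hq', h'⟩⟩
      · exact Or.inl h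
      · exact Or.inl h
      · exact Or.inl h'
      · subst h
        cases h'
        exact Or.inr ⟨q, le_inf hq hq', rfl⟩

theorem idealHom_injective [Nontrivial L] (A : SmallLattice κ) :
    Function.Injective (idealHom L A) := by
  have key : ∀ a b, ideal (L := L) A a = ideal A b → a ≤ b := fun a b hab => by
    have h : Symb.lat A a ∈ (ideal (L := L) A b).snd := by
      rw [← hab]
      exact Or.inr ⟨a, le_refl a, rfl⟩
    rcases h with h | ⟨q, hq, h⟩
    · exact (bot_ne_top h).elim
    · cases h
      exact hq
  exact fun a b hab => le_antisymm (key a b hab) (key b a hab.symm)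

end ClosedPair

end ClosedPairs

/-! ### The interpolating extension -/

namespace OrthoPoly

variable {α : Type u} {σ : Type v} [Ortholattice α]

theorem exists_eval_eq_finset_inf {ι : Type w} (s : Finset ι) (P : ι → OrthoPoly α σ) :
    ∃ Q : OrthoPoly α σ, ∀ x, Q.eval x = s.inf fun i => (P i).eval x := by
  classical
  induction s using Finset.induction with
  | empty => exact ⟨const ⊤, fun _ => rfl⟩
  | insert a s _ ih =>
    obtain ⟨Q, hQ⟩ := ih
    exact ⟨inf (P a) Q, fun x => by rw [Finset.inf_insert, ← hQ]; rfl⟩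

/-- Transport of coefficients along a map. -/
def map {β : Type w} (j : α → β) : OrthoPoly α σ → OrthoPoly β σ
  | .var i => .var i
  | .const a => .const (j a)
  | .sup p q => .sup (p.map j) (q.map j)
  | .inf p q => .inf (p.map j) (q.map j)
  | .compl p => .compl (p.map j)

theorem eval_map {β : Type w} [Ortholattice β] {j : α → β} (hj : IsOrthoEmbedding j)
    (p : OrthoPoly α σ) (x : σ → α) : (p.map j).eval (fun i => j (x i)) = j (p.eval x) := by
  induction p with
  | var i => rfl
  | const a => rfl
  | sup p q hp hq => simp only [map, eval, hp, hq, hj.map_sup]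
  | inf p q hp hq => simp only [map, eval, hp, hq, hj.map_inf]
  | compl p hp => simp only [map, eval, hp, hj.map_compl]

end OrthoPoly

section Extension

variable (L : Type u) [Ortholattice L] [hL : Fact (IsCompleteOrder L)] (κ : Cardinal.{u})

/-- The ortholattice `ortho(L₁, L)` over the lattice `L₁` of closed pairs. -/
abbrev Extension : Type u := Ortho (ClosedPair.isTriExt_baseHom L κ)

namespace Extension

variable {L κ}

open ClosedPair

/-- The embedding of `L`. -/
noncomputable abbrev base : L → Extension L κ := Ortho.base (isTriExt_baseHom L κ)

/-- The inclusion of the lattice of closed pairs. -/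
noncomputable abbrev incl : BoundedLatticeHom (ClosedPair L κ) (Extension L κ) :=
  Ortho.inLHom (isTriExt_baseHom L κ)

theorem exists_eval_eq_incl_interp (i : OpIndex L) :
    ∃ p : OrthoPoly (Extension L κ) (Fin i.arity), ∀ x : Fin i.arity → L,
      p.eval (fun k => base (x k)) = incl (interp i x) := by
  obtain ⟨Q, hQ⟩ := OrthoPoly.exists_eval_eq_finset_inf (α := Extension L κ)
    (Finset.univ : Finset (Fin i.arity × Bool))
    (fun ks => .sup (.const (incl (flagAt i ks.1 ks.2 ⊥)))
      (if ks.2 then .var ks.1 else .compl (.var ks.1)))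
  refine ⟨.sup (.inf Q (.const (incl (points i Set.univ))))
    (.const (incl (outAt i ∅ ⊥ fun _ h => h.elim))), fun x => ?_⟩
  simp only [OrthoPoly.eval, hQ, interp, map_sup, map_inf, map_finset_inf]
  congr 4
  funext ⟨k, s⟩
  rw [Function.comp_apply, map_sup]
  refine congrArg₂ (· ⊔ ·) rfl ?_
  cases s
  · exact (Ortho.base_compl (isTriExt_baseHom L κ) (x k)).symm
  · rfl

/-- Every finitary operation on `L` is an orthopolynomial over the extension. -/
theorem exists_orthoPoly {n : ℕ} (f : (Fin n → L) → L) :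
    ∃ p : OrthoPoly (Extension L κ) (Fin n), ∀ x : Fin n → L,
      p.eval (fun k => base (x k)) = base (f x) := by
  obtain ⟨p, hp⟩ := exists_eval_eq_incl_interp (κ := κ) ⟨true, n, f⟩
  obtain ⟨q, hq⟩ := exists_eval_eq_incl_interp (κ := κ) ⟨false, n, f⟩
  refine ⟨.inf p q, fun x => ?_⟩
  simp only [OrthoPoly.eval, hp, hq, ← map_inf]
  exact congrArg incl (interp_inf_interp f x)

theorem isCompleteOrder : IsCompleteOrder (Extension L κ) :=
  Ortho.isCompleteOrder _ (ClosedPair.isCompleteOrder hL.out)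

/-- The lattice structure of `T` is carried over to the range of an embedding of `T` into the
fixed set of size `κ`. -/
theorem exists_smallLattice_orderIso (T : Type u) [Lattice T] (hT : Cardinal.mk T ≤ κ) :
    ∃ A : SmallLattice κ, Nonempty (A.carrier ≃o T) := by
  rw [← Cardinal.mk_out κ] at hT
  obtain ⟨g⟩ := hT
  let ε : T ≃ Set.range g := Equiv.ofInjective g g.injective
  let _ : LE (Set.range g) := ⟨fun a b => ε.symm a ≤ ε.symm b⟩
  let _ : LT (Set.range g) := ⟨fun a b => ε.symm a < ε.symm b⟩
  let _ : Max (Set.range g) := ⟨fun a b => ε (ε.symm a ⊔ ε.symm b)⟩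
  let _ : Min (Set.range g) := ⟨fun a b => ε (ε.symm a ⊓ ε.symm b)⟩
  let str : Lattice (Set.range g) := Function.Injective.lattice ε.symm ε.symm.injective
    Iff.rfl Iff.rfl (fun _ _ => ε.symm_apply_apply _) (fun _ _ => ε.symm_apply_apply _)
  exact ⟨⟨Set.range g, str⟩, ⟨⟨ε.symm, Iff.rfl⟩⟩⟩

theorem exists_sublattice_orderIso [Nontrivial L] (T : Type u) [Lattice T]
    (hT : Cardinal.mk T ≤ κ) :
    ∃ S : Sublattice (Extension L κ), Nonempty (S ≃o T) := by
  obtain ⟨A, ⟨ε⟩⟩ := exists_smallLattice_orderIso T hT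
  let φ : LatticeHom A.carrier (Extension L κ) := incl.toLatticeHom.comp (idealHom L A)
  have hφ : Function.Injective φ :=
    (Ortho.inL_injective _).comp (idealHom_injective A)
  let δ : A.carrier ≃o Sublattice.LatticeHom.range φ :=
    ⟨Equiv.ofInjective φ hφ, fun {a b} => by
      change φ a ≤ φ b ↔ a ≤ b
      rw [← inf_eq_left, ← map_inf, hφ.eq_iff, inf_eq_left]⟩
  exact ⟨Sublattice.LatticeHom.range φ, ⟨δ.symm.trans ε⟩⟩

theorem kappaPowerClosed (hκ : Cardinal.aleph0 ≤ κ) :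
    KappaPowerClosed κ (Extension L κ) := by
  intro S hS
  rcases subsingleton_or_nontrivial L with hL' | hL'
  -- if `L` is trivial, so is the extension, and then `S ≃o S × S`
  · have h : Subsingleton (Extension L κ) := by
      refine subsingleton_of_forall_eq ⊥ fun a => le_bot_iff.1 (le_top.trans ?_)
      rw [← (Ortho.isOrthoEmbedding_base (isTriExt_baseHom L κ)).map_top,
        ← (Ortho.isOrthoEmbedding_base (isTriExt_baseHom L κ)).map_bot,
        Subsingleton.elim (⊤ : L) ⊥]
    exact ⟨S, hS, ⟨⟨⟨fun a => (a, a), Prod.fst, fun _ => rfl, fun _ => Subsingleton.elim _ _⟩,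
      fun {a b} => and_self_iff⟩⟩⟩
  · have h1 : Cardinal.mk (S × S) ≤ κ := by
      rw [Cardinal.mk_prod, Cardinal.lift_id]
      exact Cardinal.mul_le_of_le hκ hS hS
    obtain ⟨S', ⟨φ⟩⟩ := exists_sublattice_orderIso (L := L) (S × S) h1
    exact ⟨S', (Cardinal.mk_congr φ.toEquiv).trans_le h1, ⟨φ⟩⟩

end Extension

end Extension

/-! ### Convex embeddings and their directed unions -/

/-- Complete ortholattices. -/
structure CompleteOL : Type (u + 1) where
  carrier : Type u
  [str : Ortholattice carrier]
  complete : IsCompleteOrder carrier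

namespace CompleteOL

instance : CoeSort CompleteOL.{u} (Type u) := ⟨carrier⟩

instance (X : CompleteOL.{u}) : Ortholattice X := X.str

instance (X : CompleteOL.{u}) : Fact (IsCompleteOrder X) := ⟨X.complete⟩

/-- Embeddings of ortholattices with convex range. -/
@[ext]
structure Hom (X Y : CompleteOL.{u}) : Type u where
  toFun : X → Y
  emb : IsOrthoEmbedding toFun
  convex : IsConvexIn (Set.range toFun)

open CategoryTheory Limits

instance : Category CompleteOL.{u} where
  Hom := Hom
  id X := ⟨id, .id, fun _ _ _ _ x _ _ _ _ => ⟨x, rfl⟩⟩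
  comp {X Y Z} f g := ⟨g.toFun ∘ f.toFun, g.emb.comp f.emb, by
    rintro _ ⟨a, rfl⟩ _ ⟨b, rfl⟩ x ha hax hxb hb
    obtain ⟨y, rfl⟩ := g.convex _ ⟨_, rfl⟩ _ ⟨_, rfl⟩ x ha hax hxb hb
    simp only [Function.comp, g.emb.le_iff, g.emb.bot_lt_iff, g.emb.lt_top_iff]
      at ha hax hxb hb
    obtain ⟨z, rfl⟩ := f.convex _ ⟨_, rfl⟩ _ ⟨_, rfl⟩ y ha hax hxb hb
    exact ⟨z, rfl⟩⟩

theorem comp_toFun {X Y Z : CompleteOL.{u}} (f : X ⟶ Y) (g : Y ⟶ Z) (x : X) :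
    (f ≫ g).toFun x = g.toFun (f.toFun x) := rfl

instance (X Y : CompleteOL.{u}) : FunLike (X ⟶ Y) X Y where
  coe f := f.toFun
  coe_injective _ _ h := Hom.ext h

theorem hom_ext {X Y : CompleteOL.{u}} {f g : X ⟶ Y} (h : ∀ x, f.toFun x = g.toFun x) : f = g :=
  Hom.ext (funext h)

section Limit

variable {J : Type u} [LinearOrder J] (F : J ⥤ CompleteOL.{u})

/-- The transition maps of a chain. -/
def trans (i j : J) (h : i ≤ j) : F.obj i ⟶ F.obj j := F.map (homOfLE h)

instance directedSystem : DirectedSystem (fun i => (F.obj i : Type u)) (trans F · · ·) where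
  map_self i x := by
    change (F.map (𝟙 i)).toFun x = x
    rw [F.map_id]; rfl
  map_map k j i hij hjk x := by
    change (F.map (homOfLE hjk)).toFun ((F.map (homOfLE hij)).toFun x) = _
    rw [← comp_toFun, ← F.map_comp]; rfl

theorem trans_emb (i j : J) (h : i ≤ j) : IsOrthoEmbedding (trans F i j h) :=
  Hom.emb _

/-- The directed union of a chain. -/
def Lim : Type u := DirectLimit (fun i => (F.obj i : Type u)) (trans F)

namespace Lim

variable {F}

/-- The inclusion of a stage into the union. -/
def ι (i : J) (x : F.obj i) : Lim F := ⟦⟨i, x⟩⟧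

theorem ι_trans {i j : J} (h : i ≤ j) (x : F.obj i) : ι j (trans F i j h x) = ι i x :=
  DirectLimit.mk_apply (F := fun i => (F.obj i : Type u)) (f := trans F) i j x h

theorem exists_ι₂ (a b : Lim F) : ∃ i x y, a = ι (F := F) i x ∧ b = ι i y :=
  DirectLimit.exists_eq_mk₂ (trans F) a b

@[elab_as_elim]
theorem ind {C : Lim F → Prop} (ih : ∀ i x, C (ι i x)) (a : Lim F) : C a :=
  DirectLimit.induction (trans F) ih a

@[elab_as_elim]
theorem ind₂ {C : Lim F → Lim F → Prop} (ih : ∀ i x y, C (ι i x) (ι i y)) (a b : Lim F) :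
    C a b :=
  DirectLimit.induction₂ (trans F) ih a b

@[elab_as_elim]
theorem ind₃ {C : Lim F → Lim F → Lim F → Prop} (ih : ∀ i x y z, C (ι i x) (ι i y) (ι i z))
    (a b c : Lim F) : C a b c :=
  DirectLimit.induction₃ (trans F) ih a b c

theorem exists_ι_ge (a : Lim F) : ∃ i, ∀ j, i ≤ j → ∃ x, a = ι (F := F) j x := by
  induction a using ind with | ih i x =>
  exact ⟨i, fun j h => ⟨trans F i j h x, (ι_trans h x).symm⟩⟩

theorem ι_injective (i : J) : Function.Injective (ι (F := F) i) :=
  DirectLimit.mk_injective (f := trans F) (fun i j h => (trans_emb F i j h).injective) i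

noncomputable instance : Max (Lim F) :=
  ⟨DirectLimit.map₂ (trans F) (trans F) (trans F) (fun _ x y => x ⊔ y)
    fun i j h => (trans_emb F i j h).map_sup⟩

noncomputable instance : Min (Lim F) :=
  ⟨DirectLimit.map₂ (trans F) (trans F) (trans F) (fun _ x y => x ⊓ y)
    fun i j h => (trans_emb F i j h).map_inf⟩

noncomputable instance : Compl (Lim F) :=
  ⟨DirectLimit.map (trans F) (trans F) (fun _ x => xᶜ)
    fun i j h x => (trans_emb F i j h).map_compl x⟩

theorem ι_sup (i : J) (x y : F.obj i) : ι i (x ⊔ y) = ι i x ⊔ ι i y :=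
  (DirectLimit.map₂_def (trans F) (trans F) (trans F) (fun _ x y => x ⊔ y)
    (fun i j h => (trans_emb F i j h).map_sup) i x y).symm

theorem ι_inf (i : J) (x y : F.obj i) : ι i (x ⊓ y) = ι i x ⊓ ι i y :=
  (DirectLimit.map₂_def (trans F) (trans F) (trans F) (fun _ x y => x ⊓ y)
    (fun i j h => (trans_emb F i j h).map_inf) i x y).symm

theorem ι_compl (i : J) (x : F.obj i) : ι i xᶜ = (ι i x)ᶜ := rfl

noncomputable instance : LE (Lim F) := ⟨fun a b => a ⊓ b = a⟩

theorem le_iff_inf (a b : Lim F) : a ≤ b ↔ a ⊓ b = a := Iff.rfl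

theorem ι_le_ι {i : J} {x y : F.obj i} : ι i x ≤ ι i y ↔ x ≤ y := by
  rw [le_iff_inf, ← ι_inf, (ι_injective i).eq_iff, inf_eq_left]

variable [Nonempty J]

noncomputable instance : Top (Lim F) := ⟨DirectLimit.map₀ (trans F) fun _ => ⊤⟩

noncomputable instance : Bot (Lim F) := ⟨DirectLimit.map₀ (trans F) fun _ => ⊥⟩

theorem ι_top (i : J) : ι (F := F) i ⊤ = ⊤ :=
  (DirectLimit.map₀_def (trans F) _ (fun i j h => (trans_emb F i j h).map_top) i).symm

theorem ι_bot (i : J) : ι (F := F) i ⊥ = ⊥ :=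
  (DirectLimit.map₀_def (trans F) _ (fun i j h => (trans_emb F i j h).map_bot) i).symm

noncomputable instance : Ortholattice (Lim F) where
  le_refl := ind fun i x => ι_le_ι.2 le_rfl
  le_trans := ind₃ fun i x y z h1 h2 =>
    ι_le_ι.2 ((ι_le_ι.1 h1).trans (ι_le_ι.1 h2))
  le_antisymm := ind₂ fun i x y h1 h2 =>
    congrArg (ι i) ((ι_le_ι.1 h1).antisymm (ι_le_ι.1 h2))
  sup := (· ⊔ ·)
  inf := (· ⊓ ·)
  le_sup_left := ind₂ fun i x y =>
    (ι_le_ι.2 le_sup_left).trans_eq (ι_sup i x y)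
  le_sup_right := ind₂ fun i x y =>
    (ι_le_ι.2 le_sup_right).trans_eq (ι_sup i x y)
  sup_le := ind₃ fun i x y z h1 h2 =>
    (ι_sup i x y).symm.trans_le (ι_le_ι.2 (sup_le (ι_le_ι.1 h1) (ι_le_ι.1 h2)))
  inf_le_left := ind₂ fun i x y =>
    (ι_inf i x y).symm.trans_le (ι_le_ι.2 inf_le_left)
  inf_le_right := ind₂ fun i x y =>
    (ι_inf i x y).symm.trans_le (ι_le_ι.2 inf_le_right)
  le_inf := ind₃ fun i x y z h1 h2 =>
    (ι_le_ι.2 (le_inf (ι_le_ι.1 h1) (ι_le_ι.1 h2))).trans_eq (ι_inf i y z)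
  le_top := ind fun i x => (ι_le_ι.2 le_top).trans_eq (ι_top i)
  bot_le := ind fun i x => (ι_bot i).symm.trans_le (ι_le_ι.2 bot_le)
  compl_le_compl' := ind₂ fun i x y h =>
    ι_le_ι.2 (Ortholattice.compl_le_compl' _ _ (ι_le_ι.1 h))
  compl_compl' := ind fun i x => congrArg (ι i) (Ortholattice.compl_compl' x)
  sup_compl' := ind fun i x =>
    (ι_sup i x xᶜ).symm.trans ((congrArg (ι i) (Ortholattice.sup_compl' x)).trans (ι_top i))
  inf_compl' := ind fun i x =>
    (ι_inf i x xᶜ).symm.trans ((congrArg (ι i) (Ortholattice.inf_compl' x)).trans (ι_bot i))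

theorem ι_emb (i : J) : IsOrthoEmbedding (ι (F := F) i) where
  injective := ι_injective i
  map_sup := ι_sup i
  map_inf := ι_inf i
  map_bot := ι_bot i
  map_top := ι_top i
  map_compl := ι_compl i

theorem ι_convex (i : J) : IsConvexIn (Set.range (ι (F := F) i)) := by
  rintro _ ⟨a, rfl⟩ _ ⟨b, rfl⟩ x ha hax hxb hb
  obtain ⟨k, hk⟩ := exists_ι_ge x
  obtain ⟨x, rfl⟩ := hk _ (le_max_right i k)
  have h := le_max_left i k
  rw [← ι_trans h a] at ha hax
  rw [← ι_trans h b] at hb hxb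
  rw [(ι_emb _).bot_lt_iff] at ha
  rw [(ι_emb _).lt_top_iff] at hb
  rw [(ι_emb _).le_iff] at hax hxb
  obtain ⟨y, rfl⟩ := (F.map (homOfLE h)).convex _ ⟨a, rfl⟩ _ ⟨b, rfl⟩ x ha hax hxb hb
  exact ⟨y, (ι_trans h y).symm⟩

/-- A set with a nonzero element `ι a` and an upper bound `ι b ≠ ⊤` has its supremum in any
stage containing `a` and `b`, because that stage is convex and complete. -/
theorem isCompleteOrder : IsCompleteOrder (Lim F) := by
  refine Ortholattice.isCompleteOrder_of_isLUB fun s => ?_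
  by_cases h1 : ∃ a ∈ s, ⊥ < a
  · by_cases h2 : ∃ b ∈ upperBounds s, b < ⊤
    · obtain ⟨a, has, ha⟩ := h1
      obtain ⟨b, hbs, hb⟩ := h2
      obtain ⟨i, hi⟩ := exists_ι_ge a
      obtain ⟨j, hj⟩ := exists_ι_ge b
      obtain ⟨a, rfl⟩ := hi _ (le_max_left i j)
      obtain ⟨b, rfl⟩ := hj _ (le_max_right i j)
      generalize max i j = k at *
      obtain ⟨c, hc⟩ := (F.obj k).complete {x | ∃ y ∈ s, ι k x = ι k a ⊔ y} |>.1
      refine ⟨ι k c, fun y hy => ?_, fun t ht => ?_⟩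
      · obtain ⟨x, hx⟩ := ι_convex k _ ⟨a, rfl⟩ _ ⟨b, rfl⟩ (ι k a ⊔ y) ha le_sup_left
          (sup_le (hbs has) (hbs hy)) hb
        exact (le_sup_right.trans_eq hx.symm).trans (ι_le_ι.2 (hc.1 ⟨y, hy, hx⟩))
      · obtain ⟨x, hx⟩ := ι_convex k _ ⟨a, rfl⟩ _ ⟨b, rfl⟩ (ι k b ⊓ t) ha
          (le_inf (hbs has) (ht has)) inf_le_left hb
        refine le_trans ?_ (hx.trans_le inf_le_right)
        refine ι_le_ι.2 (hc.2 ?_)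
        rintro x' ⟨y, hy, hx'⟩
        rw [← ι_le_ι, hx, hx']
        exact sup_le (le_inf (hbs has) (ht has)) (le_inf (hbs hy) (ht hy))
    · refine ⟨⊤, fun _ _ => le_top, fun t ht => ?_⟩
      by_contra h
      exact h2 ⟨t, ht, lt_top_iff_ne_top.2 fun h' => h h'.ge⟩
  · refine ⟨⊥, fun a ha => ?_, fun _ _ => bot_le⟩
    by_contra h
    exact h1 ⟨a, ha, bot_lt_iff_ne_bot.2 fun h' => h h'.le⟩

end Lim

open Lim

theorem cocone_trans (c : Cocone F) (i j : J) (h : i ≤ j) (x : F.obj i) :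
    (c.ι.app i).toFun x = (c.ι.app j).toFun (trans F i j h x) := by
  rw [← c.w (homOfLE h)]; rfl

/-- The map induced on the directed union by a cocone. -/
def desc (c : Cocone F) : Lim F → c.pt :=
  DirectLimit.lift (trans F) (fun i => (c.ι.app i).toFun) (cocone_trans F c)

theorem desc_ι (c : Cocone F) (i : J) (x : F.obj i) :
    desc F c (Lim.ι i x) = (c.ι.app i).toFun x := rfl

theorem desc_convex (c : Cocone F) : IsConvexIn (Set.range (desc F c)) := by
  rintro _ ⟨a, rfl⟩ _ ⟨b, rfl⟩ x ha hax hxb hb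
  obtain ⟨i, a, b, rfl, rfl⟩ := exists_ι₂ a b
  obtain ⟨y, rfl⟩ := (c.ι.app i).convex _ ⟨a, rfl⟩ _ ⟨b, rfl⟩ x ha hax hxb hb
  exact ⟨ι i y, rfl⟩

variable [Nonempty J]

/-- The directed union as a cocone over the chain. -/
noncomputable def limCocone : Cocone F where
  pt := ⟨Lim F, Lim.isCompleteOrder⟩
  ι :=
    { app := fun i => ⟨Lim.ι i, Lim.ι_emb i, Lim.ι_convex i⟩
      naturality := fun _ _ f => hom_ext fun x => Lim.ι_trans (leOfHom f) x }

theorem desc_emb (c : Cocone F) : IsOrthoEmbedding (desc F c) where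
  injective := DirectLimit.lift_injective (trans F) _ _ fun i => (c.ι.app i).emb.injective
  map_sup := ind₂ fun i x y => by
    change desc F c (ι i x ⊔ ι i y) = desc F c (ι i x) ⊔ desc F c (ι i y)
    rw [← ι_sup, desc_ι, desc_ι, desc_ι, (c.ι.app i).emb.map_sup]
  map_inf := ind₂ fun i x y => by
    change desc F c (ι i x ⊓ ι i y) = desc F c (ι i x) ⊓ desc F c (ι i y)
    rw [← ι_inf, desc_ι, desc_ι, desc_ι, (c.ι.app i).emb.map_inf]
  map_bot := by
    rw [← ι_bot (Classical.arbitrary J), desc_ι, (c.ι.app _).emb.map_bot]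
  map_top := by
    rw [← ι_top (Classical.arbitrary J), desc_ι, (c.ι.app _).emb.map_top]
  map_compl := ind fun i x => (c.ι.app i).emb.map_compl x

/-- The directed union is the colimit. -/
noncomputable def isColimitLimCocone : IsColimit (limCocone F) where
  desc c := ⟨desc F c, desc_emb F c, desc_convex F c⟩
  fac _ _ := hom_ext fun _ => rfl
  uniq c m hm := hom_ext <| ind fun i x => by
    have := congrArg (fun f => Hom.toFun f x) (hm i)
    exact this

end Limit

instance hasColimitsOfShape (J : Type u) [LinearOrder J] [Nonempty J] :
    HasColimitsOfShape J CompleteOL.{u} :=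
  ⟨fun F => ⟨⟨⟨limCocone F, isColimitLimCocone F⟩⟩⟩⟩

end CompleteOL

/-! ### Transfinite iteration -/

namespace CompleteOL

open CategoryTheory SmallObject

/-- One step of the iteration: the interpolating extension. -/
noncomputable def succStruct (X₀ : CompleteOL.{u}) : SuccStruct CompleteOL.{u} where
  X₀ := X₀
  succ X := ⟨Extension X 0, Extension.isCompleteOrder⟩
  toSucc _ := ⟨Extension.base, Ortho.isOrthoEmbedding_base _, Ortho.isConvexIn_range_base _⟩

variable {J : Type u} [LinearOrder J] [OrderBot J] [SuccOrder J] [WellFoundedLT J]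

instance : Limits.HasIterationOfShape J CompleteOL.{u} where
  hasColimitsOfShape_of_isSuccLimit j hj :=
    have : Nonempty (Set.Iio j) := ⟨⟨⊥, hj.bot_lt⟩⟩
    hasColimitsOfShape _

/-- Coefficients of an orthopolynomial over the successor stage can be read in the union, so
every operation on a stage is an orthopolynomial over the union. -/
theorem exists_orthoPoly_of_stage [NoMaxOrder J] (X₀ : CompleteOL.{u}) (j : J) {n : ℕ}
    (f : (Fin n → ((succStruct X₀).iterationFunctor J).obj j) →
      ((succStruct X₀).iterationFunctor J).obj j) :
    ∃ p : OrthoPoly (Lim ((succStruct X₀).iterationFunctor J)) (Fin n), ∀ x,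
      p.eval (fun k => Lim.ι j (x k)) = Lim.ι j (f x) := by
  obtain ⟨p, hp⟩ := Extension.exists_orthoPoly (κ := 0) f
  let s := ((succStruct X₀).iterationFunctorObjSuccIso j (not_isMax j)).inv
  have hs : ∀ x, Lim.ι (Order.succ j) (s.toFun (Extension.base x)) = Lim.ι j x := fun x => by
    rw [← Lim.ι_trans (Order.le_succ j) x]
    refine congrArg (Lim.ι _) ?_
    change ((succStruct X₀).toSucc _ ≫ s).toFun x =
      (((succStruct X₀).iterationFunctor J).map (homOfLE (Order.le_succ j))).toFun x
    rw [(succStruct X₀).iterationFunctor_map_succ j (not_isMax j)]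
  let θ : Extension _ 0 → Lim ((succStruct X₀).iterationFunctor J) :=
    fun y => Lim.ι (Order.succ j) (s.toFun y)
  have hθ : IsOrthoEmbedding θ := (Lim.ι_emb _).comp s.emb
  refine ⟨p.map θ, fun x => ?_⟩
  have h := OrthoPoly.eval_map hθ p (fun k => Extension.base (x k))
  rw [hp] at h
  simpa only [θ, hs] using h

/-- A small set of points of the union, together with the values of `f` there, already lies in
one stage. -/
theorem exists_orthoPoly_of_lt_cof [NoMaxOrder J] (X₀ : CompleteOL.{u}) {n : ℕ}
    (f : (Fin n → Lim ((succStruct X₀).iterationFunctor J)) →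
      Lim ((succStruct X₀).iterationFunctor J))
    (A : Set (Fin n → Lim ((succStruct X₀).iterationFunctor J)))
    (hA : Cardinal.mk A < Order.cof J) :
    ∃ p : OrthoPoly (Lim ((succStruct X₀).iterationFunctor J)) (Fin n),
      ∀ a ∈ A, p.eval a = f a := by
  choose st hst using Lim.exists_ι_ge (F := (succStruct X₀).iterationFunctor J)
  choose g hg using fun a : A => Finite.exists_le fun k => st (a.1 k)
  -- fewer than `cof J` stages are bounded by a single stage `j`
  let g' : A → J := fun a => max (g a) (st (f a))
  have hg' : ¬ IsCofinal (Set.range g') := fun h =>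
    ((Order.cof_le h).trans Cardinal.mk_range_le).not_gt hA
  simp only [IsCofinal, not_forall, not_exists, Set.mem_range, not_and, not_le] at hg'
  obtain ⟨j, hj⟩ := hg'
  have hj' : ∀ a : A, g' a ≤ j := fun a => (hj _ ⟨a, rfl⟩).le
  classical
  -- outside `A` the values of `f` may leave stage `j`; the value there is immaterial
  obtain ⟨p, hp⟩ := exists_orthoPoly_of_stage X₀ j (n := n) fun x =>
    if h : ∃ v, f (fun k => Lim.ι j (x k)) = Lim.ι j v then h.choose else ⊥
  refine ⟨p, fun a ha => ?_⟩
  have h1 : ∀ k, ∃ x, a k = Lim.ι j x := fun k =>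
    hst _ _ ((hg ⟨a, ha⟩ k).trans ((le_max_left _ _).trans (hj' ⟨a, ha⟩)))
  choose x hx using h1
  obtain rfl : a = fun k => Lim.ι j (x k) := funext hx
  have h2 : ∃ v, f (fun k => Lim.ι j (x k)) = Lim.ι j v :=
    hst _ _ ((le_max_right _ _).trans (hj' ⟨_, ha⟩))
  rw [hp, dif_pos h2]
  exact h2.choose_spec.symm

end CompleteOL

theorem mainTheorem2 (L : Type u) [Ortholattice L] (hL : IsCompleteOrder L)
    (κ : Cardinal.{u}) :
    (∃ (L₁ : Type u) (_ : Lattice L₁) (_ : BoundedOrder L₁) (e : BoundedLatticeHom L L₁)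
        (h : IsTriExt e),
      IsCompleteOrder L₁ ∧
      IsCompleteOrder (Ortho h) ∧
      IsOrthoEmbedding (Ortho.base h) ∧
      (∀ f : L → L, ∃ p : OrthoPoly (Ortho h) (Fin 1),
        ∀ a : L, p.eval (fun _ => Ortho.base h a) = Ortho.base h (f a)) ∧
      IsConvexIn (Set.range (Ortho.base h)) ∧
      (Cardinal.aleph0 ≤ κ → KappaPowerClosed κ (Ortho h))) ∧
    (∃ (M : Type u) (_ : Ortholattice M) (j : L → M),
      IsCompleteOrder M ∧
      IsOrthoEmbedding j ∧
      ∀ (n : ℕ) (f : (Fin n → M) → M) (A : Set (Fin n → M)), Cardinal.mk A ≤ κ →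
        ∃ p : OrthoPoly M (Fin n), ∀ a ∈ A, p.eval a = f a) := by
  have : Fact (IsCompleteOrder L) := ⟨hL⟩
  refine ⟨⟨ClosedPair L κ, inferInstance, inferInstance, ClosedPair.baseHom L κ,
    ClosedPair.isTriExt_baseHom L κ, ClosedPair.isCompleteOrder hL, Extension.isCompleteOrder,
    Ortho.isOrthoEmbedding_base _, fun f => ?_, Ortho.isConvexIn_range_base _,
    Extension.kappaPowerClosed⟩, ?_⟩
  · obtain ⟨p, hp⟩ := Extension.exists_orthoPoly (κ := κ) fun x : Fin 1 → L => f (x 0)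
    exact ⟨p, fun a => hp fun _ => a⟩
  · let μ := Order.succ (max κ Cardinal.aleph0)
    have hμ : μ.IsRegular := Cardinal.isRegular_succ (le_max_right _ _)
    let J := μ.ord.ToType
    have hJ : Order.cof J = μ := by rw [Ordinal.cof_toType, hμ.cof_ord]
    have : NoMaxOrder J := Cardinal.noMaxOrder hμ.aleph0_le
    have : Nonempty J := Order.cof_ne_zero_iff.1 (hJ.trans_ne hμ.ne_zero)
    let _ : OrderBot J := WellFoundedLT.toOrderBot J
    let Φ := CompleteOL.succStruct ⟨L, hL⟩
    refine ⟨CompleteOL.Lim (Φ.iterationFunctor J), inferInstance,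
      CompleteOL.Lim.ι ⊥ ∘ (Φ.iterationFunctorObjBotIso J).inv.toFun,
      CompleteOL.Lim.isCompleteOrder, (CompleteOL.Lim.ι_emb _).comp (CompleteOL.Hom.emb _),
      fun n f A hA => CompleteOL.exists_orthoPoly_of_lt_cof _ f A ?_⟩
    rw [hJ]
    exact Order.lt_succ_of_le (hA.trans (le_max_left _ _))
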